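/- Let $\mathcal H$ (states) and $\mathcal V$ (controls) be real Hilbert spaces and let $T>0$. Let $A:\mathcal H\to\mathcal H$ be $C^1$ with $A(0)=0$, let $DA:\mathcal H\to\mathcal L(\mathcal H;\mathcal H)$ be differentiable, and suppose that for all $x,x_1,x_2\in\mathcal H$ $$\|DA(x)\|\le\gamma,\qquad \|DA(x_1)-DA(x_2)\|\le\frac{b\,|x_1-x_2|}{1+\max(|x_1|,|x_2|)} .$$ Let $F,F_T:\mathcal H\to\mathbb R$ be $C^2$ with $F(0)=F_T(0)=0$, $DF(0)=DF_T(0)=0$ and, for all $x,\xi\in\mathcal H$, $$\nu|\xi|^2\le (D^2F(x)\xi,\xi)\le M|\xi|^2,\qquad \nu_T|\xi|^2\le (D^2F_T(x)\xi,\xi)\le M_T|\xi|^2,\qquad \nu,\nu_T>0 .$$ Let $B\in\mathcal L(\mathcal V;\mathcal H)$ and let $N\in\mathcal L(\mathcal V;\mathcal V)$ be self-adjoint and invertible, with $(BN^{-1}B^*\xi,\xi)\ge m|\xi|^2$ for all $\xi\in\mathcal H$, where $m>0$. Assume that for some $k$ with $0<k<\min(m,\nu)$ $$\frac{b^2}{16}<(m-k)(\nu-k),\qquad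 \nu-b\,\alpha_0>0\quad\text{with}\quad \alpha_0=\frac{M_T^2}{\nu_T}+\frac{\gamma^2+M^2}{k}\,T,\qquad \gamma^2<M\,\|BN^{-1}B^*\| .$$ (1) For every $t\in[0,T]$ and $x\in\mathcal H$ the forward–backward system $$\frac{dy}{ds}=A(y)-BN^{-1}B^*z,\qquad -\frac{dz}{ds}=(DA(y))^*z+DF(y)\quad(t<s<T),\qquad y(t)=x,\quad z(T)=DF_T(y(T)),$$ has one and only one solution $(y,z)$, continuous on $[t,T]$ and differentiable on $(t,T)$. (2) For an interval $I\subset[0,T]$ with right endpoint $T\in I$, call $\Gamma:\mathcal H\times I\to\mathcal H$ a solution on $I$ of the decoupling equation if $\Gamma$ is continuous, is (Fréchet) differentiable in $(x,t)$ for $t$ in the interior of $I$, is differentiable in $x$ for every $t\in I$ with $D_x\Gamma$ bounded in a neighbourhood of each point of $\mathcal H\times I$, and satisfies $$-\frac{\partial\Gamma}{\partial t}=D_x\Gamma\,A(x)+(DA(x))^*\Gamma-D_x\Gamma\,BN^{-1}B^*\Gamma+DF(x)\quad(t\in\operatorname{int}I),\qquad \Gamma(x,T)=DF_T(x).$$ Then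 there is one and only one solution $\Gamma$ on $[0,T]$. Moreover $|\Gamma(x,t)|\le C|x|$ and $\|D_x\Gamma(x,t)\|\le C$ on $\mathcal H\times[0,T]$ for some constant $C$. This $\Gamma$ extends every local solution: for $0<h\le T$, any solution on $(T-h,T]$ is the restriction of $\Gamma$. Finally, $z(s)=\Gamma(y(s),s)$ for $s\in[t,T]$ whenever $(y,z)$ solves the system in (1). -/

import Mathlib

open Set Filter Topology
open scoped InnerProductSpace Gradient

noncomputable section

/-- The bounded operator `B N⁻¹ B*` on the state space `H`, for a bounded operator `B` from the
control space `V` to `H` and an invertible operator `N` on `V`. -/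
def controlOp {H V : Type*} [NormedAddCommGroup H] [InnerProductSpace ℝ H] [CompleteSpace H]
    [NormedAddCommGroup V] [InnerProductSpace ℝ V] [CompleteSpace V]
    (B : V →L[ℝ] H) (N : V ≃L[ℝ] V) : H →L[ℝ] H :=
  B ∘L (N.symm : V →L[ℝ] V) ∘L ContinuousLinearMap.adjoint B

/-- The coefficient `α_t = M_T² / ν_T + (γ² + M²) / k * (T - t)`. -/
def alphaCoeff (γ M MT νT k T t : ℝ) : ℝ :=
  MT ^ 2 / νT + (γ ^ 2 + M ^ 2) / k * (T - t)

/-- `(y, z)` solves on `[t, T]` the forward-backward system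
`y' = A(y) - K z`, `-z' = (DA(y))* z + DF(y)` for `t < s < T`, with `y(t) = x` and
`z(T) = DF_T(y(T))`. -/
structure IsFBSolution {H : Type*} [NormedAddCommGroup H] [InnerProductSpace ℝ H]
    [CompleteSpace H] (A : H → H) (K : H →L[ℝ] H) (F FT : H → ℝ) (t T : ℝ) (x : H)
    (y z : ℝ → H) : Prop where
  continuousOn_y : ContinuousOn y (Icc t T)
  continuousOn_z : ContinuousOn z (Icc t T)
  forward : ∀ s ∈ Ioo t T, HasDerivAt y (A (y s) - K (z s)) s
  backward : ∀ s ∈ Ioo t T, HasDerivAt z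
    (-(ContinuousLinearMap.adjoint (fderiv ℝ A (y s)) (z s) + ∇ F (y s))) s
  initial : y t = x
  final : z T = ∇ FT (y T)

/-- `Γ(x, t)` is a classical solution, for `x ∈ H` and `t` in the time interval `I` ending at `T`,
of `-∂Γ/∂t = DₓΓ A(x) + (DA(x))* Γ - DₓΓ K Γ + DF(x)` in the interior of `I`, with
`Γ(x, T) = DF_T(x)`. It is continuous on `H × I`, differentiable in the pair `(x, t)` for `t`
interior to `I`, and differentiable in `x` for every `t ∈ I`, with an `x`-derivative that is
bounded near each point of `H × I`. -/
structure IsDecouplingSolution {H : Type*} [NormedAddCommGroup H] [InnerProductSpace ℝ H]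
    [CompleteSpace H] (A : H → H) (K : H →L[ℝ] H) (F FT : H → ℝ) (T : ℝ) (I : Set ℝ)
    (Γ : H → ℝ → H) : Prop where
  continuousOn : ContinuousOn (fun p : H × ℝ => Γ p.1 p.2) (univ ×ˢ I)
  differentiableAt : ∀ x : H, ∀ t ∈ interior I,
    DifferentiableAt ℝ (fun p : H × ℝ => Γ p.1 p.2) (x, t)
  differentiable_space : ∀ t ∈ I, Differentiable ℝ (fun x : H => Γ x t)
  locally_bounded : ∀ x : H, ∀ t ∈ I, ∃ C : ℝ,
    ∀ᶠ p : H × ℝ in 𝓝[univ ×ˢ I] (x, t), ‖fderiv ℝ (fun x' : H => Γ x' p.2) p.1‖ ≤ C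
  equation : ∀ x : H, ∀ t ∈ interior I,
    -deriv (fun s : ℝ => Γ x s) t =
      fderiv ℝ (fun x' : H => Γ x' t) x (A x)
        + ContinuousLinearMap.adjoint (fderiv ℝ A x) (Γ x t)
        - fderiv ℝ (fun x' : H => Γ x' t) x (K (Γ x t))
        + ∇ F x
  final : ∀ x : H, Γ x T = ∇ FT x

end

/-!
Two a priori estimates carry the proof. Along a solution `(y, z)` of the forward-backward system,
`⟪y, z⟫` decreases at rate `k (‖y‖² + ‖z‖²)`: the error `A y - DA(y) y` is at most `b ‖y‖ / 2`, and
`b² / 16 < (m - k) (ν - k)` lets the coercivity of `B N⁻¹ B*` and of `D²F` absorb it. Hence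
`⟪y, z⟫ - ‖z‖² / α` is nonincreasing and nonnegative at `T`, so that `‖z‖ ≤ α ‖y‖`
(`sq_norm_le_alphaCoeff_mul_inner`, `FBHypotheses.norm_backward_le`). For the difference of two
solutions, this bound, the decay of `D²A` and `ν - b α > 0` make the system strictly monotone, and
the same energy argument applies (`FBHypotheses.exists_comparison`). It shows that a solution is
unique, that `z t` is a Lipschitz function of `y t`, and that so is `y T`.

Existence comes from solving the system backwards from `y T = η`, `z T = DF_T(η)`. This is an
initial value problem; by the a priori bound its solutions stay where a globally Lipschitz
truncation agrees with the original field (`FBHypotheses.exists_characteristics`). The map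
`η ↦ y t` expands distances up to a constant factor, uniformly in `t`, and is the identity for
`t = T`; it varies with `t` in a Lipschitz way, so it stays surjective while `t` decreases by a
fixed amount, and hence down to `t = 0` (`FBHypotheses.exists_characteristic_through`). Thus every
`(x, t)` lies on one characteristic, and `Γ (x, t)` is the value `z t` on it.

The second derivative of `A` need not be continuous. The flow is nevertheless differentiable in
`η`: the Picard operator is differentiable by dominated convergence
(`differentiableAt_weightedPicard`), and a Lipschitz inverse of a differentiable bijection is
differentiable (`differentiableAt_inverse_of_lipschitzWith`). The same fact, applied to `η ↦ y t`,
gives the derivative of `Γ` in `x`. Moving along the characteristics gives the derivative in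
`(x, t)` and the decoupling equation (`hasFDerivAt_field`). Conversely, for a solution `Γ'` of the
decoupling equation, `Γ' (y, s) - z` satisfies along a characteristic a linear homogeneous equation
and vanishes at `T` (`FBHypotheses.decouplingSolution_along`), so that `Γ' = Γ`.
-/

/-! ### Bijections perturbed by small Lipschitz maps, and inverses of differentiable bijections -/

/-- A surjection that expands distances stays surjective under a perturbation with a small
Lipschitz constant: `h a = x` is the fixed point equation `a = f⁻¹ (x - (h - f) a)`. -/
theorem surjective_of_lipschitz_perturbation {E F : Type*} [NormedAddCommGroup E]
    [CompleteSpace E] [NormedAddCommGroup F] {f h : E → F} {c ε : ℝ} (hc : 0 ≤ c) (hε : 0 ≤ ε)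
    (hanti : ∀ a a', ‖a - a'‖ ≤ c * ‖f a - f a'‖) (hf : Function.Surjective f)
    (hh : ∀ a a', ‖(h a - f a) - (h a' - f a')‖ ≤ ε * ‖a - a'‖) (hcε : c * ε < 1) :
    Function.Surjective h := by
  intro x
  obtain ⟨φ, hφ⟩ := hf.hasRightInverse
  have hK : ContractingWith (c * ε).toNNReal (fun a => φ (x - (h a - f a))) := by
    refine ⟨by simpa using hcε, LipschitzWith.of_dist_le_mul fun a a' => ?_⟩
    rw [Real.coe_toNNReal _ (mul_nonneg hc hε), dist_eq_norm, dist_eq_norm]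
    calc _ ≤ c * ‖f (φ (x - (h a - f a))) - f (φ (x - (h a' - f a')))‖ := hanti _ _
      _ = c * ‖(h a - f a) - (h a' - f a')‖ := by rw [hφ, hφ, ← norm_neg]; congr 2; abel
      _ ≤ c * (ε * ‖a - a'‖) := by gcongr; exact hh _ _
      _ = _ := by ring
  obtain ⟨a, ha⟩ : ∃ a, φ (x - (h a - f a)) = a := ⟨_, hK.fixedPoint_isFixedPt⟩
  have h2 := hφ (x - (h a - f a))
  rw [ha] at h2
  exact ⟨a, by rw [← sub_eq_zero, ← sub_eq_zero.2 h2]; abel⟩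

/-- The inverse `g` of a bijection `f` of Banach spaces is differentiable at `a` as soon as `g` is
Lipschitz and `f` is differentiable at `g a`; the derivative of `f` need not be continuous nor be
known to be invertible. Its kernel and the closedness of its range are controlled by the Lipschitz
constant of `g`, and its range is dense since `t • w` is attained by `f` up to `o(t)`. -/
theorem differentiableAt_inverse_of_lipschitzWith {E F : Type*} [NormedAddCommGroup E]
    [NormedSpace ℝ E] [CompleteSpace E] [NormedAddCommGroup F] [NormedSpace ℝ F] [CompleteSpace F]
    {f : E → F} {g : F → E} {C : NNReal} (hg : LipschitzWith C g) (hfg : ∀ y, f (g y) = y)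
    (hgf : ∀ x, g (f x) = x) {a : F} (hf : DifferentiableAt ℝ f (g a)) :
    DifferentiableAt ℝ g a := by
  set D := fderiv ℝ f (g a) with hD
  have hfD : HasFDerivAt f D (g a) := hf.hasFDerivAt
  have hbelow : ∀ v, ‖v‖ ≤ C * ‖D v‖ := by
    intro v
    have hc : Tendsto (fun n : ℕ => ‖(n : ℝ)‖) atTop atTop :=
      tendsto_norm_atTop_atTop.comp tendsto_natCast_atTop_atTop
    have hlim := ((hfD.lim v hc).norm).const_mul (C : ℝ)
    refine ge_of_tendsto hlim ?_
    filter_upwards [eventually_gt_atTop 0] with n hn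
    have hn' : (n : ℝ) ≠ 0 := by positivity
    have h1 := hg.dist_le_mul (f (g a + (n : ℝ)⁻¹ • v)) (f (g a))
    rw [hgf, hgf, dist_eq_norm, dist_eq_norm, add_sub_cancel_left, norm_smul] at h1
    rw [norm_smul]
    calc ‖v‖ = ‖(n : ℝ)‖ * (‖(n : ℝ)⁻¹‖ * ‖v‖) := by
          rw [← mul_assoc, ← norm_mul, mul_inv_cancel₀ hn']; simp
      _ ≤ ‖(n : ℝ)‖ * (C * ‖f (g a + (n : ℝ)⁻¹ • v) - f (g a)‖) := by gcongr
      _ = _ := by ring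
  have hanti : AntilipschitzWith C D := D.antilipschitz_of_bound hbelow
  have hclosed : IsClosed (Set.range D) := hanti.isClosed_range D.uniformContinuous
  have hlittle : (fun y => y - a - D (g y - g a)) =o[𝓝 a] fun y => y - a := by
    have h1 := (hasFDerivAt_iff_isLittleO.1 hfD).comp_tendsto hg.continuous.continuousAt
    have h2 : (fun y => g y - g a) =O[𝓝 a] fun y => y - a :=
      Asymptotics.IsBigO.of_bound C (Eventually.of_forall fun y => by
        simpa [dist_eq_norm] using hg.dist_le_mul y a)
    refine (h1.trans_isBigO h2).congr_left fun y => ?_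
    simp [hfg]
  have hsurj : Set.range D = univ := by
    rw [← hclosed.closure_eq]
    refine eq_univ_of_forall fun w => ?_
    refine Metric.mem_closure_iff.2 fun ε hε => ?_
    have hpos : 0 < ε / (2 * (‖w‖ + 1)) := by positivity
    have hev := hlittle.def hpos
    have htend : Tendsto (fun t : ℝ => a + t • w) (𝓝[>] 0) (𝓝 a) := by
      have : Tendsto (fun t : ℝ => a + t • w) (𝓝 0) (𝓝 (a + (0 : ℝ) • w)) :=
        (by fun_prop : Continuous fun t : ℝ => a + t • w).tendsto 0
      rw [zero_smul, add_zero] at this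
      exact this.mono_left nhdsWithin_le_nhds
    obtain ⟨t, ht, ht0⟩ := ((htend.eventually hev).and self_mem_nhdsWithin).exists
    have ht0 : 0 < t := ht0
    refine ⟨D (t⁻¹ • (g (a + t • w) - g a)), ⟨_, rfl⟩, ?_⟩
    rw [add_sub_cancel_left, norm_smul, Real.norm_of_nonneg ht0.le] at ht
    have h1 : w - D (t⁻¹ • (g (a + t • w) - g a))
        = t⁻¹ • (t • w - D (g (a + t • w) - g a)) := by
      rw [map_smul, smul_sub, smul_smul, inv_mul_cancel₀ ht0.ne', one_smul]
    rw [dist_eq_norm, h1, norm_smul, norm_inv, Real.norm_of_nonneg ht0.le]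
    calc t⁻¹ * ‖t • w - D (g (a + t • w) - g a)‖
        ≤ t⁻¹ * (ε / (2 * (‖w‖ + 1)) * (t * ‖w‖)) := by gcongr
      _ = ε * (‖w‖ / (2 * (‖w‖ + 1))) := by field_simp
      _ < ε * 1 := by
          gcongr
          rw [div_lt_one (by positivity)]
          linarith [norm_nonneg w]
      _ = ε := mul_one _
  let e : E ≃L[ℝ] F := ContinuousLinearEquiv.ofBijective D
    (LinearMap.ker_eq_bot.2 hanti.injective) (LinearMap.range_eq_top.2 (range_eq_univ.1 hsurj))
  have he : (e : E →L[ℝ] F) = D := by ext; rfl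
  exact (HasFDerivAt.of_local_left_inverse hg.continuous.continuousAt (he ▸ hfD)
    (Eventually.of_forall hfg)).differentiableAt

/-! ### The flow of a Lipschitz vector field and its differentiability -/

section Flow

open MeasureTheory

variable {E : Type*} [NormedAddCommGroup E] [NormedSpace ℝ E]

/-- The retraction of `ℝ` onto `[0, T]`. -/
def clampTime (T τ : ℝ) : ℝ := max 0 (min τ T)

theorem continuous_clampTime (T : ℝ) : Continuous (clampTime T) := by
  unfold clampTime; fun_prop

theorem clampTime_mem {T : ℝ} (hT : 0 ≤ T) (τ : ℝ) : clampTime T τ ∈ Icc 0 T :=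
  ⟨le_max_left _ _, max_le hT (min_le_right _ _)⟩

theorem clampTime_of_mem {T τ : ℝ} (hτ : τ ∈ Icc 0 T) : clampTime T τ = τ := by
  rw [clampTime, min_eq_left hτ.2, max_eq_right hτ.1]

/-- The function `τ ↦ exp (-l τ) ∫₀^τ u` on `[0, T]`, continued by constants to a bounded
continuous function on `ℝ`. -/
noncomputable def weightedPrimitive {l T : ℝ} (hl : 0 ≤ l) (hT : 0 ≤ T) (u : ℝ → E)
    (hu : IntegrableOn u (Icc 0 T)) : BoundedContinuousFunction ℝ E :=
  BoundedContinuousFunction.ofNormedAddCommGroup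
    (fun τ => Real.exp (-(l * clampTime T τ)) • ∫ r in (0 : ℝ)..clampTime T τ, u r)
    (by
      have h1 : ContinuousOn (fun s => ∫ r in (0 : ℝ)..s, u r) (Icc 0 T) := by
        have := intervalIntegral.continuousOn_primitive_interval (a := 0) (b := T) (f := u)
          (μ := volume) (by rwa [uIcc_of_le hT])
        rwa [uIcc_of_le hT] at this
      have h2 := h1.comp_continuous (continuous_clampTime T) (clampTime_mem hT)
      have h3 := continuous_clampTime T
      exact (Real.continuous_exp.comp (by fun_prop)).smul h2)
    (∫ r in (0 : ℝ)..T, ‖u r‖)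
    (fun τ => by
      have hc := clampTime_mem hT τ
      rw [norm_smul, Real.norm_of_nonneg (Real.exp_pos _).le]
      have hexp : Real.exp (-(l * clampTime T τ)) ≤ 1 :=
        Real.exp_le_one_iff.2 (neg_nonpos.2 (mul_nonneg hl hc.1))
      have hint : IntervalIntegrable (fun r => ‖u r‖) volume 0 T :=
        (intervalIntegrable_iff_integrableOn_Icc_of_le hT).2 hu.norm
      calc _ ≤ 1 * ∫ r in (0 : ℝ)..clampTime T τ, ‖u r‖ := by
            gcongr
            exact intervalIntegral.norm_integral_le_integral_norm hc.1
        _ ≤ ∫ r in (0 : ℝ)..T, ‖u r‖ := by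
            rw [one_mul]
            exact intervalIntegral.integral_mono_interval le_rfl hc.1 hc.2
              (Eventually.of_forall fun r => norm_nonneg _) hint)

theorem weightedPrimitive_apply {l T : ℝ} (hl : 0 ≤ l) (hT : 0 ≤ T) {u : ℝ → E}
    (hu : IntegrableOn u (Icc 0 T)) (τ : ℝ) : weightedPrimitive hl hT u hu τ =
      Real.exp (-(l * clampTime T τ)) • ∫ r in (0 : ℝ)..clampTime T τ, u r := rfl

theorem norm_weightedPrimitive_le {l T : ℝ} (hl : 0 ≤ l) (hT : 0 ≤ T) {u : ℝ → E}
    (hu : IntegrableOn u (Icc 0 T)) :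
    ‖weightedPrimitive hl hT u hu‖ ≤ ∫ r in (0 : ℝ)..T, ‖u r‖ :=
  BoundedContinuousFunction.norm_ofNormedAddCommGroup_le _
    (intervalIntegral.integral_nonneg hT fun _ _ => norm_nonneg _) _

theorem intervalIntegrable_clampTime {F : Type*} [NormedAddCommGroup F] {T : ℝ} (hT : 0 ≤ T)
    {u : ℝ → F}
    (hu : IntegrableOn u (Icc 0 T)) (τ : ℝ) : IntervalIntegrable u volume 0 (clampTime T τ) :=
  (intervalIntegrable_iff_integrableOn_Icc_of_le (clampTime_mem hT τ).1).2
    (hu.mono_set (Icc_subset_Icc_right (clampTime_mem hT τ).2))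

theorem weightedPrimitive_add {l T : ℝ} (hl : 0 ≤ l) (hT : 0 ≤ T) {u v w : ℝ → E}
    (hu : IntegrableOn u (Icc 0 T)) (hv : IntegrableOn v (Icc 0 T))
    (hw : IntegrableOn w (Icc 0 T)) (h : ∀ r, w r = u r + v r) :
    weightedPrimitive hl hT w hw = weightedPrimitive hl hT u hu + weightedPrimitive hl hT v hv := by
  ext τ
  simp only [weightedPrimitive_apply, BoundedContinuousFunction.add_apply, ← smul_add, h]
  rw [intervalIntegral.integral_add (intervalIntegrable_clampTime hT hu τ)
    (intervalIntegrable_clampTime hT hv τ)]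

theorem weightedPrimitive_sub {l T : ℝ} (hl : 0 ≤ l) (hT : 0 ≤ T) {u v w : ℝ → E}
    (hu : IntegrableOn u (Icc 0 T)) (hv : IntegrableOn v (Icc 0 T))
    (hw : IntegrableOn w (Icc 0 T)) (h : ∀ r, w r = u r - v r) :
    weightedPrimitive hl hT w hw = weightedPrimitive hl hT u hu - weightedPrimitive hl hT v hv := by
  ext τ
  simp only [weightedPrimitive_apply, BoundedContinuousFunction.sub_apply, ← smul_sub, h]
  rw [intervalIntegral.integral_sub (intervalIntegrable_clampTime hT hu τ)
    (intervalIntegrable_clampTime hT hv τ)]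

theorem weightedPrimitive_smul {l T : ℝ} (hl : 0 ≤ l) (hT : 0 ≤ T) (c : ℝ) {u w : ℝ → E}
    (hu : IntegrableOn u (Icc 0 T)) (hw : IntegrableOn w (Icc 0 T)) (h : ∀ r, w r = c • u r) :
    weightedPrimitive hl hT w hw = c • weightedPrimitive hl hT u hu := by
  ext τ
  simp only [weightedPrimitive_apply, BoundedContinuousFunction.smul_apply, h]
  rw [intervalIntegral.integral_smul, smul_comm]

theorem integrableOn_field {g : E → E} (hg : Continuous g) (l T : ℝ)
    (U : BoundedContinuousFunction ℝ E) :
    IntegrableOn (fun r => g (Real.exp (l * r) • U r)) (Icc 0 T) := by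
  have := U.continuous
  exact (by fun_prop : Continuous fun r => g (Real.exp (l * r) • U r)).continuousOn.integrableOn_Icc

/-- The Picard integral operator of the vector field `g` for the rescaled unknown
`U τ = exp (-l τ) X τ`. The weight turns it into a contraction when `l` is large. -/
noncomputable def weightedPicard {g : E → E} (hg : Continuous g) {l T : ℝ} (hl : 0 ≤ l) (hT : 0 ≤ T)
    (U : BoundedContinuousFunction ℝ E) : BoundedContinuousFunction ℝ E :=
  weightedPrimitive hl hT (fun r => g (Real.exp (l * r) • U r)) (integrableOn_field hg l T U)

theorem norm_weightedPicard_sub_le {g : E → E} {L : NNReal} (hg : LipschitzWith L g) {l T : ℝ}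
    (hl : 0 < l) (hT : 0 ≤ T) (U V : BoundedContinuousFunction ℝ E) :
    ‖weightedPicard hg.continuous hl.le hT U - weightedPicard hg.continuous hl.le hT V‖
      ≤ L / l * ‖U - V‖ := by
  refine (BoundedContinuousFunction.norm_le (by positivity)).2 fun τ => ?_
  have hc := (clampTime_mem hT τ).1
  set c := clampTime T τ with hcdef
  simp only [BoundedContinuousFunction.sub_apply, weightedPicard, weightedPrimitive_apply,
    ← smul_sub, ← hcdef]
  rw [← intervalIntegral.integral_sub
    (intervalIntegrable_clampTime hT (integrableOn_field hg.continuous l T U) τ)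
    (intervalIntegrable_clampTime hT (integrableOn_field hg.continuous l T V) τ), norm_smul,
    Real.norm_of_nonneg (Real.exp_pos _).le, ← hcdef]
  have hbound : ‖∫ r in (0 : ℝ)..c, (g (Real.exp (l * r) • U r) - g (Real.exp (l * r) • V r))‖
      ≤ ∫ r in (0 : ℝ)..c, L * ‖U - V‖ * Real.exp (l * r) := by
    refine intervalIntegral.norm_integral_le_of_norm_le hc ?_
      (Continuous.intervalIntegrable (by fun_prop) _ _)
    refine Eventually.of_forall fun r _ => ?_
    have h1 := hg.dist_le_mul (Real.exp (l * r) • U r) (Real.exp (l * r) • V r)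
    rw [dist_eq_norm, dist_eq_norm, ← smul_sub, norm_smul,
      Real.norm_of_nonneg (Real.exp_pos _).le] at h1
    have h2 : ‖U r - V r‖ ≤ ‖U - V‖ := (U - V).norm_coe_le_norm r
    calc _ ≤ (L : ℝ) * (Real.exp (l * r) * ‖U r - V r‖) := h1
      _ ≤ L * (Real.exp (l * r) * ‖U - V‖) := by gcongr
      _ = _ := by ring
  have hint : ∫ r in (0 : ℝ)..c, L * ‖U - V‖ * Real.exp (l * r)
      = L * ‖U - V‖ * ((Real.exp (l * c) - 1) / l) := by
    rw [intervalIntegral.integral_const_mul, intervalIntegral.integral_comp_mul_left _ hl.ne']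
    simp [div_eq_inv_mul]
  rw [hint] at hbound
  calc _ ≤ Real.exp (-(l * c)) * (L * ‖U - V‖ * ((Real.exp (l * c) - 1) / l)) := by gcongr
    _ ≤ Real.exp (-(l * c)) * (L * ‖U - V‖ * (Real.exp (l * c) / l)) := by gcongr; linarith
    _ = Real.exp (-(l * c)) * Real.exp (l * c) * (L / l * ‖U - V‖) := by ring
    _ = _ := by rw [← Real.exp_add]; simp

theorem integrableOn_fderiv_apply {g : E → E} {L : NNReal} (hg : LipschitzWith L g) {T : ℝ}
    {X w : ℝ → E} (hX : Continuous X) (hw : Continuous w)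
    (hdiff : ∀ r ∈ Icc 0 T, DifferentiableAt ℝ g (X r)) :
    IntegrableOn (fun r => fderiv ℝ g (X r) (w r)) (Icc 0 T) := by
  have hgc := hg.continuous
  have hc : Tendsto (fun n : ℕ => ‖(n : ℝ)‖) atTop atTop :=
    tendsto_norm_atTop_atTop.comp tendsto_natCast_atTop_atTop
  refine Integrable.mono' (g := fun r => L * ‖w r‖)
    (by fun_prop : Continuous fun r => (L : ℝ) * ‖w r‖).continuousOn.integrableOn_Icc ?_
    (Eventually.of_forall fun r => ?_)
  · -- the derivative is a pointwise limit of continuous difference quotients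
    refine aestronglyMeasurable_of_tendsto_ae atTop
      (f := fun (n : ℕ) r => (n : ℝ) • (g (X r + (n : ℝ)⁻¹ • w r) - g (X r))) (fun n => ?_) ?_
    · exact (by fun_prop : Continuous _).aestronglyMeasurable
    · filter_upwards [ae_restrict_mem measurableSet_Icc] with r hr
      exact (hdiff r hr).hasFDerivAt.lim (w r) hc
  · exact ((fderiv ℝ g (X r)).le_opNorm _).trans
      (mul_le_mul_of_nonneg_right (norm_fderiv_le_of_lipschitz ℝ hg) (norm_nonneg _))

theorem integrableOn_picardDeriv {g : E → E} {L : NNReal} (hg : LipschitzWith L g) {l T : ℝ}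
    {U : BoundedContinuousFunction ℝ E}
    (hdiff : ∀ r ∈ Icc 0 T, DifferentiableAt ℝ g (Real.exp (l * r) • U r))
    (V : BoundedContinuousFunction ℝ E) :
    IntegrableOn (fun r => fderiv ℝ g (Real.exp (l * r) • U r) (Real.exp (l * r) • V r))
      (Icc 0 T) := by
  have hUc := U.continuous
  have hVc := V.continuous
  exact integrableOn_fderiv_apply hg (X := fun r => Real.exp (l * r) • U r) (by fun_prop)
    (by fun_prop) hdiff

/-- The Picard operator linearized along `exp (l r) • U r` is a bounded operator. -/
theorem exists_picardDeriv {g : E → E} {L : NNReal} (hg : LipschitzWith L g) {l T : ℝ}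
    (hl : 0 ≤ l) (hT : 0 ≤ T) {U : BoundedContinuousFunction ℝ E}
    (hdiff : ∀ r ∈ Icc 0 T, DifferentiableAt ℝ g (Real.exp (l * r) • U r)) :
    ∃ D : BoundedContinuousFunction ℝ E →L[ℝ] BoundedContinuousFunction ℝ E,
      ∀ V, D V = weightedPrimitive hl hT _ (integrableOn_picardDeriv hg hdiff V) := by
  let D : BoundedContinuousFunction ℝ E →ₗ[ℝ] BoundedContinuousFunction ℝ E :=
    { toFun := fun V => weightedPrimitive hl hT _ (integrableOn_picardDeriv hg hdiff V)
      map_add' := fun V W => weightedPrimitive_add hl hT _ _ _ fun r => by simp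
      map_smul' := fun c V => weightedPrimitive_smul hl hT c _ _ fun r => by
        simp [smul_comm c] }
  refine ⟨D.mkContinuous (T * (L * Real.exp (l * T))) fun V => ?_, fun V => rfl⟩
  refine (norm_weightedPrimitive_le hl hT (integrableOn_picardDeriv hg hdiff V)).trans ?_
  have h1 : ∀ r ∈ Icc 0 T, ‖fderiv ℝ g (Real.exp (l * r) • U r) (Real.exp (l * r) • V r)‖
      ≤ L * Real.exp (l * T) * ‖V‖ := fun r hr => by
    refine (ContinuousLinearMap.le_opNorm _ _).trans ?_
    rw [norm_smul, Real.norm_of_nonneg (Real.exp_pos _).le, mul_assoc]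
    gcongr
    · exact norm_fderiv_le_of_lipschitz ℝ hg
    · exact hr.2
    · exact V.norm_coe_le_norm r
  have h2 := intervalIntegral.integral_mono_on hT
    ((intervalIntegrable_iff_integrableOn_Icc_of_le hT).2
      (integrableOn_picardDeriv hg hdiff V).norm)
    (intervalIntegrable_const (μ := volume)) h1
  refine h2.trans (le_of_eq ?_)
  rw [intervalIntegral.integral_const, smul_eq_mul]; ring

/-- The Picard operator is Fréchet differentiable at `U` if `g` is differentiable at the values of
`exp (l r) • U r`. Continuity of the derivative of `g` is not needed: the remainder tends to `0`
pointwise in time, and dominated convergence applies. -/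
theorem differentiableAt_weightedPicard {g : E → E} {L : NNReal} (hg : LipschitzWith L g) {l T : ℝ}
    (hl : 0 ≤ l) (hT : 0 ≤ T) {U : BoundedContinuousFunction ℝ E}
    (hdiff : ∀ r ∈ Icc 0 T, DifferentiableAt ℝ g (Real.exp (l * r) • U r)) :
    DifferentiableAt ℝ (weightedPicard hg.continuous hl hT) U := by
  obtain ⟨𝒯, h𝒯⟩ := exists_picardDeriv hg hl hT hdiff
  have hexp : ∀ r ∈ Icc 0 T, Real.exp (l * r) ≤ Real.exp (l * T) := fun r hr =>
    Real.exp_le_exp.2 (mul_le_mul_of_nonneg_left hr.2 hl)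
  have hint := integrableOn_picardDeriv hg hdiff
  set D : ℝ → E →L[ℝ] E := fun r => fderiv ℝ g (Real.exp (l * r) • U r) with hD
  have hDbound : ∀ r, ‖D r‖ ≤ L := fun r => norm_fderiv_le_of_lipschitz ℝ hg
  refine HasFDerivAt.differentiableAt (f' := 𝒯) (hasFDerivAt_iff_tendsto.2 ?_)
  set R : BoundedContinuousFunction ℝ E → ℝ → E := fun V r =>
    g (Real.exp (l * r) • V r) - g (Real.exp (l * r) • U r) - D r (Real.exp (l * r) • (V - U) r)
    with hR
  have hRint : ∀ V, IntegrableOn (R V) (Icc 0 T) := fun V =>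
    ((integrableOn_field hg.continuous l T V).sub (integrableOn_field hg.continuous l T U)).sub
      (hint (V - U))
  have hlim : Tendsto (fun V => ∫ r in (0 : ℝ)..T, ‖V - U‖⁻¹ * ‖R V r‖) (𝓝 U)
      (𝓝 (∫ r in (0 : ℝ)..T, (0 : ℝ))) := by
    refine intervalIntegral.tendsto_integral_filter_of_dominated_convergence
      (fun _ => (L + L) * Real.exp (l * T)) ?_ ?_ intervalIntegrable_const ?_
    · refine Eventually.of_forall fun V => ?_
      rw [uIoc_of_le hT]
      exact (((hRint V).mono_set Ioc_subset_Icc_self).aestronglyMeasurable.norm).const_mul _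
    · refine Eventually.of_forall fun V => Eventually.of_forall fun r hr => ?_
      rw [uIoc_of_le hT] at hr
      have hr' := hexp r (Ioc_subset_Icc_self hr)
      rw [Real.norm_of_nonneg (by positivity)]
      have hVU : ‖Real.exp (l * r) • (V - U) r‖ ≤ Real.exp (l * T) * ‖V - U‖ := by
        rw [norm_smul, Real.norm_of_nonneg (Real.exp_pos _).le]
        gcongr
        exact (V - U).norm_coe_le_norm r
      have h1 : ‖g (Real.exp (l * r) • V r) - g (Real.exp (l * r) • U r)‖
          ≤ L * (Real.exp (l * T) * ‖V - U‖) := by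
        have := hg.dist_le_mul (Real.exp (l * r) • V r) (Real.exp (l * r) • U r)
        rw [dist_eq_norm, dist_eq_norm, ← smul_sub] at this
        exact this.trans (mul_le_mul_of_nonneg_left hVU L.2)
      have h2 : ‖D r (Real.exp (l * r) • (V - U) r)‖ ≤ L * (Real.exp (l * T) * ‖V - U‖) :=
        ((D r).le_opNorm _).trans (mul_le_mul (hDbound r) hVU (norm_nonneg _) L.2)
      have h3 : ‖R V r‖ ≤ (L + L) * Real.exp (l * T) * ‖V - U‖ :=
        (norm_sub_le _ _).trans ((add_le_add h1 h2).trans (le_of_eq (by ring)))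
      rcases eq_or_lt_of_le (norm_nonneg (V - U)) with h0 | h0
      · rw [← h0]; simp; positivity
      · rw [inv_mul_le_iff₀ h0]; linarith
    · refine Eventually.of_forall fun r hr => ?_
      rw [uIoc_of_le hT] at hr
      let ev : BoundedContinuousFunction ℝ E →L[ℝ] E :=
        Real.exp (l * r) • BoundedContinuousFunction.evalCLM ℝ r
      have hev_apply : ∀ V : BoundedContinuousFunction ℝ E, ev V = Real.exp (l * r) • V r :=
        fun V => rfl
      have hev : HasFDerivAt (fun V : BoundedContinuousFunction ℝ E => g (ev V))
          ((D r).comp ev) U :=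
        HasFDerivAt.comp U (f := ev) (hdiff r (Ioc_subset_Icc_self hr)).hasFDerivAt
          ev.hasFDerivAt
      have := hasFDerivAt_iff_tendsto.1 hev
      simpa only [ContinuousLinearMap.comp_apply, hev_apply] using this
  rw [intervalIntegral.integral_zero] at hlim
  refine squeeze_zero (fun V => by positivity) (fun V => ?_) hlim
  have h1 : weightedPicard hg.continuous hl hT V - weightedPicard hg.continuous hl hT U - 𝒯 (V - U)
      = weightedPrimitive hl hT (R V) (hRint V) := by
    rw [h𝒯, weightedPicard, weightedPicard, ← weightedPrimitive_sub hl hT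
      (integrableOn_field hg.continuous l T V) (integrableOn_field hg.continuous l T U)
      ((integrableOn_field hg.continuous l T V).sub (integrableOn_field hg.continuous l T U))
      fun r => rfl]
    exact (weightedPrimitive_sub hl hT _ _ _ fun r => rfl).symm
  rw [h1, intervalIntegral.integral_const_mul]
  gcongr
  exact norm_weightedPrimitive_le hl hT _

/-- A globally Lipschitz vector field `g` has a flow `φ x τ` for `τ ∈ [0, T]`. The flow is Lipschitz
in the initial point `x`, also for the increments in time, and it is differentiable in `x` as soon
as `g` is differentiable at the points of the trajectory of `x`. -/
theorem exists_flow_of_lipschitzWith [CompleteSpace E] {g : E → E} {L : NNReal}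
    (hg : LipschitzWith L g) {T : ℝ} (hT : 0 ≤ T) :
    ∃ (φ : E → ℝ → E) (C : NNReal), (∀ x, Continuous (φ x)) ∧ (∀ x, φ x 0 = x) ∧
      (∀ x, ∀ τ ∈ Ioo 0 T, HasDerivAt (φ x) (g (φ x τ)) τ) ∧
      (∀ τ, LipschitzWith C fun x => φ x τ) ∧
      (∀ x x', ∀ τ ∈ Icc 0 T, ∀ τ' ∈ Icc 0 T,
        ‖(φ x τ' - φ x' τ') - (φ x τ - φ x' τ)‖ ≤ C * |τ' - τ| * ‖x - x'‖) ∧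
      ∀ x, (∀ r ∈ Icc 0 T, DifferentiableAt ℝ g (φ x r)) →
        ∀ τ, DifferentiableAt ℝ (fun x => φ x τ) x := by
  have hgc := hg.continuous
  -- with this weight the Picard operator is a contraction with constant `1 / 2`
  obtain ⟨l, hl, hLl⟩ : ∃ l : ℝ, 0 < l ∧ (L : ℝ) / l ≤ 1 / 2 :=
    ⟨2 * L + 1, by positivity, by rw [div_le_iff₀ (by positivity)]; linarith⟩
  set N := weightedPicard hgc hl.le hT with hN
  have hNlip : ∀ U V, ‖N U - N V‖ ≤ 1 / 2 * ‖U - V‖ := fun U V =>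
    (norm_weightedPicard_sub_le hg hl hT U V).trans (by gcongr)
  have hcontr : ∀ f : BoundedContinuousFunction ℝ E,
      ContractingWith (1 / 2 : NNReal) fun U => f + N U := fun f =>
    ⟨by norm_num, LipschitzWith.of_dist_le_mul fun U V => by
      rw [dist_eq_norm, dist_eq_norm, add_sub_add_left_eq_sub]
      simpa using hNlip U V⟩
  choose sol hsol using fun f : BoundedContinuousFunction ℝ E =>
    (⟨_, (hcontr f).fixedPoint_isFixedPt⟩ : ∃ U, f + N U = U)
  have hsol_lip : LipschitzWith 2 sol := LipschitzWith.of_dist_le_mul fun f f' => by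
    rw [dist_eq_norm, dist_eq_norm]
    have h1 : sol f - sol f' = (f - f') + (N (sol f) - N (sol f')) := by
      conv_lhs => rw [← hsol f, ← hsol f']
      abel
    have h2 := norm_add_le (f - f') (N (sol f) - N (sol f'))
    rw [← h1] at h2
    have h3 := hNlip (sol f) (sol f')
    rw [NNReal.coe_ofNat]
    linarith
  have hleft : ∀ U, sol (U - N U) = U := fun U => by
    have h1 : sol (U - N U) - U = N (sol (U - N U)) - N U := by
      conv_lhs => rw [← hsol (U - N U)]
      abel
    have h2 := hNlip (sol (U - N U)) U
    rw [← h1] at h2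
    exact sub_eq_zero.1 (norm_eq_zero.1 (by linarith [norm_nonneg (sol (U - N U) - U)]))
  have hright : ∀ f, sol f - N (sol f) = f := fun f => by
    rw [sub_eq_iff_eq_add]; exact (hsol f).symm
  have hweight : Continuous fun τ => Real.exp (-(l * clampTime T τ)) := by
    have := continuous_clampTime T
    exact Real.continuous_exp.comp (by fun_prop)
  have hweight_le : ∀ τ, Real.exp (-(l * clampTime T τ)) ≤ 1 := fun τ =>
    Real.exp_le_one_iff.2 (neg_nonpos.2 (mul_nonneg hl.le (clampTime_mem hT τ).1))
  have hweight_norm : ∀ τ (x : E), ‖Real.exp (-(l * clampTime T τ)) • x‖ ≤ ‖x‖ := fun τ x => by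
    rw [norm_smul, Real.norm_of_nonneg (Real.exp_pos _).le]
    exact mul_le_of_le_one_left (norm_nonneg _) (hweight_le τ)
  -- the rescaled constant function with value `x`
  obtain ⟨cst, hcst⟩ : ∃ cst : E →L[ℝ] BoundedContinuousFunction ℝ E,
      ∀ x τ, cst x τ = Real.exp (-(l * clampTime T τ)) • x :=
    ⟨LinearMap.mkContinuous
      { toFun := fun x => BoundedContinuousFunction.ofNormedAddCommGroup
          (fun τ => Real.exp (-(l * clampTime T τ)) • x) (hweight.smul continuous_const) ‖x‖
          (fun τ => hweight_norm τ x)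
        map_add' := fun x y => by ext τ; simp
        map_smul' := fun c x => by ext τ; simp [smul_comm c] } 1
      (fun x => by
        rw [one_mul]
        exact (BoundedContinuousFunction.norm_le (norm_nonneg _)).2 fun τ => hweight_norm τ x),
      fun x τ => rfl⟩
  have hcst_norm : ∀ x, ‖cst x‖ ≤ ‖x‖ := fun x =>
    (BoundedContinuousFunction.norm_le (norm_nonneg _)).2 fun τ => by
      rw [hcst]; exact hweight_norm τ x
  set φ : E → ℝ → E := fun x τ => Real.exp (l * clampTime T τ) • sol (cst x) τ with hφ
  have hφ_cont : ∀ x, Continuous (φ x) := fun x => by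
    have h1 := continuous_clampTime T
    have h2 := (sol (cst x)).continuous
    exact (Real.continuous_exp.comp (by fun_prop)).smul h2
  have hφ_mem : ∀ x, ∀ r ∈ Icc 0 T, φ x r = Real.exp (l * r) • sol (cst x) r := fun x r hr => by
    rw [hφ]; simp only [clampTime_of_mem hr]
  have hφ_eq : ∀ x τ, τ ∈ Icc 0 T → φ x τ = x + ∫ r in (0 : ℝ)..τ, g (φ x r) := by
    intro x τ hτ
    have h1 : ∫ r in (0 : ℝ)..τ, g (φ x r)
        = ∫ r in (0 : ℝ)..τ, g (Real.exp (l * r) • sol (cst x) r) := by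
      refine intervalIntegral.integral_congr fun r hr => ?_
      rw [uIcc_of_le hτ.1] at hr
      simp only [hφ_mem x r ⟨hr.1, hr.2.trans hτ.2⟩]
    rw [h1, hφ_mem x τ hτ]
    conv_lhs => rw [← hsol (cst x)]
    rw [BoundedContinuousFunction.add_apply, hcst, hN, weightedPicard, weightedPrimitive_apply,
      clampTime_of_mem hτ, smul_add, smul_smul, smul_smul, ← Real.exp_add, add_neg_cancel,
      Real.exp_zero, one_smul, one_smul]
  have hφ_lip : ∀ τ x x', ‖φ x τ - φ x' τ‖ ≤ 2 * Real.exp (l * T) * ‖x - x'‖ := by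
    intro τ x x'
    have h1 : ‖sol (cst x) τ - sol (cst x') τ‖ ≤ 2 * ‖x - x'‖ := by
      have h2 := hsol_lip.dist_le_mul (cst x) (cst x')
      rw [dist_eq_norm, dist_eq_norm, ← map_sub] at h2
      exact ((sol (cst x) - sol (cst x')).norm_coe_le_norm τ).trans
        (h2.trans (mul_le_mul_of_nonneg_left (hcst_norm _) (by positivity)))
    rw [hφ]
    simp only [← smul_sub, norm_smul, Real.norm_of_nonneg (Real.exp_pos _).le]
    have h3 : Real.exp (l * clampTime T τ) ≤ Real.exp (l * T) :=
      Real.exp_le_exp.2 (mul_le_mul_of_nonneg_left (clampTime_mem hT τ).2 hl.le)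
    calc _ ≤ Real.exp (l * T) * (2 * ‖x - x'‖) := by gcongr
      _ = _ := by ring
  have hgφ : ∀ x, Continuous fun r => g (φ x r) := fun x => hgc.comp (hφ_cont x)
  have hint : ∀ x a b, IntervalIntegrable (fun r => g (φ x r)) volume a b := fun x a b =>
    (hgφ x).intervalIntegrable a b
  refine ⟨φ, ⟨(1 + L) * (2 * Real.exp (l * T)), by positivity⟩, hφ_cont, fun x => ?_, ?_, ?_, ?_, ?_⟩
  · rw [hφ_eq x 0 ⟨le_rfl, hT⟩]; simp
  · intro x τ hτ
    have h1 : HasDerivAt (fun τ => x + ∫ r in (0 : ℝ)..τ, g (φ x r)) (g (φ x τ)) τ :=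
      (intervalIntegral.integral_hasDerivAt_right (hint x _ _)
        ((hgφ x).stronglyMeasurableAtFilter _ _) (hgφ x).continuousAt).const_add x
    refine h1.congr_of_eventuallyEq ?_
    filter_upwards [Icc_mem_nhds hτ.1 hτ.2] with r hr using hφ_eq x r hr
  · refine fun τ => LipschitzWith.of_dist_le_mul fun x x' => ?_
    rw [dist_eq_norm, dist_eq_norm]
    refine (hφ_lip τ x x').trans ?_
    have : (0 : ℝ) ≤ L := L.2
    change _ ≤ (1 + (L : ℝ)) * (2 * Real.exp (l * T)) * ‖x - x'‖
    have h1 : 0 ≤ L * (2 * Real.exp (l * T)) * ‖x - x'‖ := by positivity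
    linarith
  · intro x x' τ hτ τ' hτ'
    have h1 : (φ x τ' - φ x' τ') - (φ x τ - φ x' τ)
        = ∫ r in τ..τ', (g (φ x r) - g (φ x' r)) := by
      rw [intervalIntegral.integral_sub (hint _ _ _) (hint _ _ _), hφ_eq x τ' hτ', hφ_eq x τ hτ,
        hφ_eq x' τ' hτ', hφ_eq x' τ hτ,
        ← intervalIntegral.integral_interval_sub_left (hint x 0 τ') (hint x 0 τ),
        ← intervalIntegral.integral_interval_sub_left (hint x' 0 τ') (hint x' 0 τ)]
      abel
    rw [h1]
    have h2 := intervalIntegral.norm_integral_le_of_norm_le_const (a := τ) (b := τ')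
      (f := fun r => g (φ x r) - g (φ x' r)) (C := L * (2 * Real.exp (l * T) * ‖x - x'‖))
      fun r _ => by
        have h3 := hg.dist_le_mul (φ x r) (φ x' r)
        rw [dist_eq_norm, dist_eq_norm] at h3
        exact h3.trans (mul_le_mul_of_nonneg_left (hφ_lip r x x') L.2)
    refine h2.trans ?_
    change _ ≤ (1 + (L : ℝ)) * (2 * Real.exp (l * T)) * |τ' - τ| * ‖x - x'‖
    have h4 : 0 ≤ 2 * Real.exp (l * T) * |τ' - τ| * ‖x - x'‖ := by positivity
    linarith
  · intro x hx τ
    have h1 : DifferentiableAt ℝ (fun U => U - N U) (sol (cst x)) := by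
      refine differentiableAt_id.sub (differentiableAt_weightedPicard hg hl.le hT fun r hr => ?_)
      rw [← hφ_mem x r hr]
      exact hx r hr
    have h2 : DifferentiableAt ℝ sol (cst x) :=
      differentiableAt_inverse_of_lipschitzWith hsol_lip hright hleft h1
    have h3 : DifferentiableAt ℝ (fun x => sol (cst x)) x := h2.comp x cst.differentiableAt
    exact ((BoundedContinuousFunction.evalCLM ℝ τ).differentiableAt.comp x h3).const_smul
      (Real.exp (l * clampTime T τ))

end Flow

/-! ### Energy estimates -/

section Energy

variable {H : Type*} [NormedAddCommGroup H] [InnerProductSpace ℝ H]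

theorem antitoneOn_Icc_of_hasDerivAt_nonpos {f f' : ℝ → ℝ} {a b : ℝ}
    (hf : ContinuousOn f (Icc a b)) (hf' : ∀ s ∈ Ioo a b, HasDerivAt f (f' s) s)
    (hle : ∀ s ∈ Ioo a b, f' s ≤ 0) : AntitoneOn f (Icc a b) := by
  refine antitoneOn_of_deriv_nonpos (convex_Icc a b) hf ?_ ?_
  · rw [interior_Icc]
    exact fun s hs => (hf' s hs).differentiableAt.differentiableWithinAt
  · rw [interior_Icc]
    exact fun s hs => by rw [(hf' s hs).deriv]; exact hle s hs

/-- If `⟪y, z⟫` decreases at rate at least `κ (‖y‖² + ‖z‖²)` and `z' = O(‖y‖ + ‖z‖)`, then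
`⟪y, z⟫ - ‖z‖² / β` is nonincreasing for `β s = MT² / νT + (γ² + M²) / κ * (T - s)`. As it is
nonnegative at `T`, the square `‖z‖²` is at most `β ⟪y, z⟫` everywhere. -/
theorem sq_norm_le_alphaCoeff_mul_inner {y z y' z' : ℝ → H} {t T γ M κ νT MT : ℝ}
    (hκ : 0 < κ) (hνT : 0 < νT) (hMT : 0 < MT)
    (hy : ContinuousOn y (Icc t T)) (hz : ContinuousOn z (Icc t T))
    (hy' : ∀ s ∈ Ioo t T, HasDerivAt y (y' s) s) (hz' : ∀ s ∈ Ioo t T, HasDerivAt z (z' s) s)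
    (hdiss : ∀ s ∈ Ioo t T, ⟪y' s, z s⟫_ℝ + ⟪y s, z' s⟫_ℝ ≤ -κ * (‖y s‖ ^ 2 + ‖z s‖ ^ 2))
    (hgrowth : ∀ s ∈ Ioo t T, ‖z' s‖ ≤ γ * ‖z s‖ + M * ‖y s‖)
    (hfinal : νT * ‖y T‖ ^ 2 ≤ ⟪y T, z T⟫_ℝ) (hfinal' : ‖z T‖ ≤ MT * ‖y T‖)
    {s : ℝ} (hs : s ∈ Icc t T) :
    ‖z s‖ ^ 2 ≤ alphaCoeff γ M MT νT κ T s * ⟪y s, z s⟫_ℝ := by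
  set β : ℝ → ℝ := alphaCoeff γ M MT νT κ T with hβ
  have hβ_pos : ∀ s ≤ T, 0 < β s := fun s hs => by
    have : 0 ≤ (γ ^ 2 + M ^ 2) / κ * (T - s) :=
      mul_nonneg (by positivity) (sub_nonneg.2 hs)
    have h2 : 0 < MT ^ 2 / νT := by positivity
    simp only [hβ, alphaCoeff]; linarith
  have hβ' : ∀ s, HasDerivAt β (-((γ ^ 2 + M ^ 2) / κ)) s := fun s => by
    have := (((hasDerivAt_id s).const_sub T).const_mul ((γ ^ 2 + M ^ 2) / κ)).const_add
      (MT ^ 2 / νT)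
    exact this.congr_deriv (by ring)
  have hanti : AntitoneOn (fun s => ⟪y s, z s⟫_ℝ - ⟪z s, z s⟫_ℝ / β s) (Icc t T) := by
    refine antitoneOn_Icc_of_hasDerivAt_nonpos
      (f' := fun s => (⟪y s, z' s⟫_ℝ + ⟪y' s, z s⟫_ℝ)
        - ((⟪z s, z' s⟫_ℝ + ⟪z' s, z s⟫_ℝ) * β s
          - ⟪z s, z s⟫_ℝ * (-((γ ^ 2 + M ^ 2) / κ))) / β s ^ 2) ?_ ?_ ?_
    · refine (hy.inner hz).sub ((hz.inner hz).div ?_ fun s hs => (hβ_pos s hs.2).ne')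
      exact fun s _ => (hβ' s).continuousAt.continuousWithinAt
    · exact fun s hs => ((hy' s hs).inner ℝ (hz' s hs)).sub
        (((hz' s hs).inner ℝ (hz' s hs)).div (hβ' s) (hβ_pos s hs.2.le).ne')
    · intro s hs
      have hb := hβ_pos s hs.2.le
      have h1 := hdiss s hs
      have h2 : -⟪z s, z' s⟫_ℝ ≤ ‖z s‖ * (γ * ‖z s‖ + M * ‖y s‖) :=
        (neg_le_abs _).trans ((abs_real_inner_le_norm _ _).trans
          (mul_le_mul_of_nonneg_left (hgrowth s hs) (norm_nonneg _)))
      have h3 : (⟪z s, z' s⟫_ℝ + ⟪z' s, z s⟫_ℝ) * β s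
          - ⟪z s, z s⟫_ℝ * (-((γ ^ 2 + M ^ 2) / κ))
          = 2 * ⟪z s, z' s⟫_ℝ * β s + ‖z s‖ ^ 2 * ((γ ^ 2 + M ^ 2) / κ) := by
        rw [real_inner_comm (z' s) (z s), real_inner_self_eq_norm_sq]; ring
      rw [h3]
      have h4 : (2 * ⟪z s, z' s⟫_ℝ * β s + ‖z s‖ ^ 2 * ((γ ^ 2 + M ^ 2) / κ)) / β s ^ 2
          = 2 * ⟪z s, z' s⟫_ℝ / β s + (‖z s‖ / β s) ^ 2 * ((γ ^ 2 + M ^ 2) / κ) := by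
        field_simp
      rw [h4]
      set u := ‖z s‖ / β s with hu
      have h5 : -(2 * ⟪z s, z' s⟫_ℝ / β s) ≤ 2 * u * (γ * ‖z s‖ + M * ‖y s‖) := by
        have : 2 * u * (γ * ‖z s‖ + M * ‖y s‖)
            = 2 * (‖z s‖ * (γ * ‖z s‖ + M * ‖y s‖)) / β s := by rw [hu]; ring
        rw [this, ← neg_div]
        gcongr
        linarith
      -- Young's inequality for the two products
      have hyoung : ∀ a c : ℝ, 2 * u * (c * a) ≤ κ * a ^ 2 + u ^ 2 * (c ^ 2 / κ) := fun a c => by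
        have h6 : κ * a ^ 2 + u ^ 2 * (c ^ 2 / κ) - 2 * u * (c * a) = (κ * a - u * c) ^ 2 / κ := by
          field_simp; ring
        have h7 : 0 ≤ (κ * a - u * c) ^ 2 / κ := by positivity
        linarith
      have h8 := hyoung ‖z s‖ γ
      have h9 := hyoung ‖y s‖ M
      have h10 : u ^ 2 * ((γ ^ 2 + M ^ 2) / κ) = u ^ 2 * (γ ^ 2 / κ) + u ^ 2 * (M ^ 2 / κ) := by
        ring
      rw [h10]
      linarith
  have htT : t ≤ T := hs.1.trans hs.2
  have h1 : ⟪y T, z T⟫_ℝ - ⟪z T, z T⟫_ℝ / β T ≤ ⟪y s, z s⟫_ℝ - ⟪z s, z s⟫_ℝ / β s :=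
    hanti hs ⟨htT, le_rfl⟩ hs.2
  have h2 : 0 ≤ ⟪y T, z T⟫_ℝ - ⟪z T, z T⟫_ℝ / β T := by
    have h3 : β T = MT ^ 2 / νT := by simp [hβ, alphaCoeff]
    have h4 : ⟪z T, z T⟫_ℝ / β T ≤ νT * ‖y T‖ ^ 2 := by
      rw [real_inner_self_eq_norm_sq, h3, div_le_iff₀ (by positivity)]
      calc ‖z T‖ ^ 2 ≤ (MT * ‖y T‖) ^ 2 := by gcongr
        _ = _ := by field_simp
    linarith
  rw [real_inner_self_eq_norm_sq (z s)] at h1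
  have h5 : ‖z s‖ ^ 2 / β s ≤ ⟪y s, z s⟫_ℝ := by linarith
  rw [div_le_iff₀ (hβ_pos s hs.2)] at h5
  linarith

theorem alphaCoeff_pos {γ M κ νT MT T s : ℝ} (hκ : 0 < κ) (hνT : 0 < νT) (hMT : 0 < MT)
    (hs : s ≤ T) : 0 < alphaCoeff γ M MT νT κ T s := by
  have h1 : 0 ≤ (γ ^ 2 + M ^ 2) / κ * (T - s) := mul_nonneg (by positivity) (sub_nonneg.2 hs)
  have h2 : 0 < MT ^ 2 / νT := by positivity
  simp only [alphaCoeff]; linarith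

theorem alphaCoeff_le {γ M κ νT MT T s s' : ℝ} (hκ : 0 < κ) (hs : s' ≤ s) :
    alphaCoeff γ M MT νT κ T s ≤ alphaCoeff γ M MT νT κ T s' := by
  simp only [alphaCoeff]
  gcongr

/-- Under the hypotheses of the energy estimate, `z` is controlled by `y`, the final value of `y` by
any earlier value, and both vanish if `y` vanishes at the initial time. -/
theorem energy_estimates {y z y' z' : ℝ → H} {t T γ M κ νT MT : ℝ} (htT : t ≤ T)
    (hκ : 0 < κ) (hνT : 0 < νT) (hMT : 0 < MT)
    (hy : ContinuousOn y (Icc t T)) (hz : ContinuousOn z (Icc t T))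
    (hy' : ∀ s ∈ Ioo t T, HasDerivAt y (y' s) s) (hz' : ∀ s ∈ Ioo t T, HasDerivAt z (z' s) s)
    (hdiss : ∀ s ∈ Ioo t T, ⟪y' s, z s⟫_ℝ + ⟪y s, z' s⟫_ℝ ≤ -κ * (‖y s‖ ^ 2 + ‖z s‖ ^ 2))
    (hgrowth : ∀ s ∈ Ioo t T, ‖z' s‖ ≤ γ * ‖z s‖ + M * ‖y s‖)
    (hfinal : νT * ‖y T‖ ^ 2 ≤ ⟪y T, z T⟫_ℝ) (hfinal' : ‖z T‖ ≤ MT * ‖y T‖) :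
    (∀ s ∈ Icc t T, ‖z s‖ ≤ alphaCoeff γ M MT νT κ T s * ‖y s‖) ∧
      νT * ‖y T‖ ^ 2 ≤ alphaCoeff γ M MT νT κ T t * ‖y t‖ ^ 2 ∧
      (y t = 0 → ∀ s ∈ Icc t T, y s = 0 ∧ z s = 0) := by
  have hmain := fun s hs => sq_norm_le_alphaCoeff_mul_inner hκ hνT hMT hy hz hy' hz' hdiss hgrowth
    hfinal hfinal' (s := s) hs
  have hz_le : ∀ s ∈ Icc t T, ‖z s‖ ≤ alphaCoeff γ M MT νT κ T s * ‖y s‖ := by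
    intro s hs
    have hβ := alphaCoeff_pos (γ := γ) (M := M) (MT := MT) hκ hνT hMT hs.2
    rcases eq_or_lt_of_le (norm_nonneg (z s)) with h0 | h0
    · rw [← h0]; positivity
    · have h1 := (hmain s hs).trans
        (mul_le_mul_of_nonneg_left (real_inner_le_norm (y s) (z s)) hβ.le)
      refine le_of_mul_le_mul_right ?_ h0
      nlinarith
  have hanti : AntitoneOn (fun s => ⟪y s, z s⟫_ℝ) (Icc t T) :=
    antitoneOn_Icc_of_hasDerivAt_nonpos (hy.inner hz)
      (fun s hs => (hy' s hs).inner ℝ (hz' s hs)) fun s hs => by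
        have h1 := hdiss s hs
        have h2 : 0 ≤ κ * (‖y s‖ ^ 2 + ‖z s‖ ^ 2) := by positivity
        linarith
  have ht : t ∈ Icc t T := ⟨le_rfl, htT⟩
  have hT : T ∈ Icc t T := ⟨htT, le_rfl⟩
  refine ⟨hz_le, ?_, fun h0 => ?_⟩
  · have h1 : ⟪y T, z T⟫_ℝ ≤ ⟪y t, z t⟫_ℝ := hanti ht hT htT
    have h2 := real_inner_le_norm (y t) (z t)
    have h3 := mul_le_mul_of_nonneg_left (hz_le t ht) (norm_nonneg (y t))
    nlinarith
  · have hp_zero : ∀ s ∈ Icc t T, ⟪y s, z s⟫_ℝ = 0 := by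
      intro s hs
      have hβ := alphaCoeff_pos (γ := γ) (M := M) (MT := MT) hκ hνT hMT hs.2
      have h1 : ⟪y s, z s⟫_ℝ ≤ ⟪y t, z t⟫_ℝ := hanti ht hs hs.1
      rw [h0, inner_zero_left] at h1
      exact le_antisymm h1 (nonneg_of_mul_nonneg_right ((sq_nonneg _).trans (hmain s hs)) hβ)
    have hz_zero : ∀ s ∈ Icc t T, z s = 0 := by
      intro s hs
      have h1 := hmain s hs
      rw [hp_zero s hs, mul_zero] at h1
      exact norm_eq_zero.1 (pow_eq_zero_iff two_ne_zero |>.1 (le_antisymm h1 (sq_nonneg _)))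
    have hy_zero : ∀ s ∈ Ioo t T, y s = 0 := by
      intro s hs
      -- the pairing is constant, so its derivative vanishes
      have h1 : HasDerivAt (fun s => ⟪y s, z s⟫_ℝ) 0 s :=
        (hasDerivAt_const s (0 : ℝ)).congr_of_eventuallyEq (by
          filter_upwards [Icc_mem_nhds hs.1 hs.2] with r hr using hp_zero r hr)
      have h2 := h1.unique ((hy' s hs).inner ℝ (hz' s hs))
      have h3 := hdiss s hs
      have h4 : κ * (‖y s‖ ^ 2 + ‖z s‖ ^ 2) ≤ 0 := by linarith
      have h5 : ‖y s‖ ^ 2 ≤ 0 := by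
        have := nonpos_of_mul_nonpos_right h4 hκ
        nlinarith [sq_nonneg ‖z s‖]
      exact norm_eq_zero.1 (pow_eq_zero_iff two_ne_zero |>.1 (le_antisymm h5 (sq_nonneg _)))
    refine fun s hs => ⟨?_, hz_zero s hs⟩
    rcases eq_or_lt_of_le hs.1 with h | h
    · rw [← h, h0]
    rcases eq_or_lt_of_le hs.2 with h' | h'
    · rw [h']
      have h1 := hp_zero T hT
      rw [h1] at hfinal
      have h2 : ‖y T‖ ^ 2 ≤ 0 := nonpos_of_mul_nonpos_right hfinal hνT
      exact norm_eq_zero.1 (pow_eq_zero_iff two_ne_zero |>.1 (le_antisymm h2 (sq_nonneg _)))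
    · exact hy_zero s ⟨h, h'⟩

end Energy

/-! ### Gradients of strongly convex functions and the Taylor remainder of the drift -/

section Gradient

variable {H : Type*} [NormedAddCommGroup H] [InnerProductSpace ℝ H]

/-- A symmetric operator with `0 ≤ ⟪S ξ, ξ⟫ ≤ M ‖ξ‖²` has norm at most `M`, by polarization. -/
theorem norm_apply_le_of_quadratic_form_le {S : H →L[ℝ] H} {M : ℝ}
    (hsymm : ∀ ξ η, ⟪S ξ, η⟫_ℝ = ⟪S η, ξ⟫_ℝ) (hnonneg : ∀ ξ, 0 ≤ ⟪S ξ, ξ⟫_ℝ)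
    (hle : ∀ ξ, ⟪S ξ, ξ⟫_ℝ ≤ M * ‖ξ‖ ^ 2) (hM : 0 ≤ M) (ξ : H) : ‖S ξ‖ ≤ M * ‖ξ‖ := by
  rcases eq_or_ne ξ 0 with rfl | hξ
  · simp
  rcases eq_or_ne (S ξ) 0 with h0 | h0
  · rw [h0, norm_zero]; positivity
  have hξ' : 0 < ‖ξ‖ := norm_pos_iff.2 hξ
  have h0' : 0 < ‖S ξ‖ := norm_pos_iff.2 h0
  -- the vector of the length of `ξ` in the direction of `S ξ`
  set η : H := (‖ξ‖ / ‖S ξ‖) • S ξ with hη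
  have hηnorm : ‖η‖ = ‖ξ‖ := by
    rw [hη, norm_smul, Real.norm_of_nonneg (by positivity)]; field_simp
  have h1 : 4 * ⟪S ξ, η⟫_ℝ = ⟪S (ξ + η), ξ + η⟫_ℝ - ⟪S (ξ - η), ξ - η⟫_ℝ := by
    simp only [map_add, map_sub, inner_add_left, inner_add_right, inner_sub_left, inner_sub_right,
      hsymm η ξ]
    ring
  have h2 : ‖ξ + η‖ ≤ 2 * ‖ξ‖ := (norm_add_le _ _).trans (by rw [hηnorm]; linarith)
  have h3 : ⟪S ξ, η⟫_ℝ = ‖ξ‖ * ‖S ξ‖ := by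
    rw [hη, real_inner_smul_right, real_inner_self_eq_norm_sq]; field_simp
  have h4 : ⟪S (ξ + η), ξ + η⟫_ℝ ≤ M * (2 * ‖ξ‖) ^ 2 := (hle _).trans (by gcongr)
  have h5 := hnonneg (ξ - η)
  refine le_of_mul_le_mul_left ?_ hξ'
  nlinarith

theorem norm_taylor_remainder_le {A : H → H} {b : ℝ} (hA : Differentiable ℝ A) (hb : 0 ≤ b)
    (hlip : ∀ x₁ x₂, ‖fderiv ℝ A x₁ - fderiv ℝ A x₂‖ ≤ b * ‖x₁ - x₂‖ / (1 + max ‖x₁‖ ‖x₂‖))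
    (x y : H) : ‖A y - A x - fderiv ℝ A x (y - x)‖ ≤ b / 2 * ‖y - x‖ ^ 2 / (1 + ‖x‖) := by
  set d := y - x with hd
  have hline : ∀ θ : ℝ, HasDerivAt (fun θ : ℝ => x + θ • d) d θ := fun θ => by
    simpa using ((hasDerivAt_id θ).smul_const d).const_add x
  have hder : ∀ θ : ℝ, HasDerivAt (fun θ : ℝ => A (x + θ • d) - A x - θ • fderiv ℝ A x d)
      (fderiv ℝ A (x + θ • d) d - fderiv ℝ A x d) θ := fun θ => by
    have h1 := (hA (x + θ • d)).hasFDerivAt.comp_hasDerivAt θ (hline θ)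
    exact ((h1.sub_const (A x)).sub
      ((hasDerivAt_id θ).smul_const (fderiv ℝ A x d))).congr_deriv (by rw [one_smul])
  have hB : ∀ θ : ℝ, HasDerivAt (fun θ : ℝ => b / 2 * ‖d‖ ^ 2 / (1 + ‖x‖) * θ ^ 2)
      (b * ‖d‖ ^ 2 / (1 + ‖x‖) * θ) θ := fun θ =>
    ((hasDerivAt_pow 2 θ).const_mul (b / 2 * ‖d‖ ^ 2 / (1 + ‖x‖))).congr_deriv (by
      simp; ring)
  have h := image_norm_le_of_norm_deriv_right_le_deriv_boundary (a := 0) (b := 1)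
    (fun θ _ => (hder θ).continuousAt.continuousWithinAt)
    (fun θ _ => (hder θ).hasDerivWithinAt) (by simp) hB (fun θ hθ => ?_)
    (right_mem_Icc.2 zero_le_one)
  · simpa [hd] using h
  · rw [← sub_apply]
    refine (ContinuousLinearMap.le_opNorm _ _).trans ?_
    have h1 := hlip (x + θ • d) x
    rw [add_sub_cancel_left, norm_smul, Real.norm_of_nonneg hθ.1] at h1
    have h2 : b * (θ * ‖d‖) / (1 + max ‖x + θ • d‖ ‖x‖) ≤ b * (θ * ‖d‖) / (1 + ‖x‖) := by
      have := hθ.1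
      gcongr
      exact le_max_right _ _
    calc _ ≤ b * (θ * ‖d‖) / (1 + ‖x‖) * ‖d‖ := by gcongr; exact h1.trans h2
      _ = _ := by ring

variable [CompleteSpace H]

theorem isBoundedLinearMap_toDual_symm :
    IsBoundedLinearMap ℝ fun l : H →L[ℝ] ℝ => (InnerProductSpace.toDual ℝ H).symm l where
  map_add x y := by simp
  map_smul c x := by simp
  bound := ⟨1, one_pos, fun x => by simp⟩

theorem ContDiff.gradient {f : H → ℝ} (hf : ContDiff ℝ 2 f) : ContDiff ℝ 1 (∇ f) := by
  have h1 : ContDiff ℝ 1 (fderiv ℝ f) := hf.fderiv_right (by norm_num)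
  exact (isBoundedLinearMap_toDual_symm (H := H)).contDiff.comp h1

theorem inner_fderiv_gradient {f : H → ℝ} (hf : ContDiff ℝ 2 f) (x ξ η : H) :
    ⟪fderiv ℝ (∇ f) x ξ, η⟫_ℝ = fderiv ℝ (fderiv ℝ f) x ξ η := by
  have h1 : ContDiff ℝ 1 (fderiv ℝ f) := hf.fderiv_right (by norm_num)
  have h2 : fderiv ℝ f = fun x => InnerProductSpace.toDual ℝ H (∇ f x) := by
    funext x; exact ((InnerProductSpace.toDual ℝ H).apply_symm_apply _).symm
  have h3 := ((h1.differentiable one_ne_zero) x).hasFDerivAt.clm_apply (hasFDerivAt_const η x)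
  have h4 := ((hf.gradient.differentiable one_ne_zero) x).hasFDerivAt.inner ℝ
    (hasFDerivAt_const η x)
  have h5 : (fun x => fderiv ℝ f x η) = fun x => ⟪∇ f x, η⟫_ℝ := by
    funext x; rw [h2]; simp
  rw [h5] at h3
  have h6 := congrArg (fun l : H →L[ℝ] ℝ => l ξ) (h3.unique h4)
  simpa using h6.symm

variable {f : H → ℝ} {ν M : ℝ}

theorem lipschitz_gradient (hf : ContDiff ℝ 2 f) (hν : 0 ≤ ν) (hM : 0 ≤ M)
    (hess : ∀ x ξ, ν * ‖ξ‖ ^ 2 ≤ ⟪fderiv ℝ (∇ f) x ξ, ξ⟫_ℝ ∧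
      ⟪fderiv ℝ (∇ f) x ξ, ξ⟫_ℝ ≤ M * ‖ξ‖ ^ 2) (x y : H) :
    ‖∇ f x - ∇ f y‖ ≤ M * ‖x - y‖ := by
  refine convex_univ.norm_image_sub_le_of_norm_fderiv_le (𝕜 := ℝ)
    (fun z _ => (hf.gradient.differentiable one_ne_zero) z) (fun z _ => ?_) (mem_univ y)
    (mem_univ x)
  refine ContinuousLinearMap.opNorm_le_bound _ hM fun ξ =>
    norm_apply_le_of_quadratic_form_le (fun ξ η => ?_) (fun ξ => ?_) (fun ξ => (hess z ξ).2) hM ξ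
  · rw [inner_fderiv_gradient hf, inner_fderiv_gradient hf]
    exact (hf.contDiffAt (x := z)).isSymmSndFDerivAt (by simp) ξ η
  · exact le_trans (by positivity) (hess z ξ).1

theorem strong_monotone_gradient (hf : ContDiff ℝ 2 f)
    (hess : ∀ x ξ, ν * ‖ξ‖ ^ 2 ≤ ⟪fderiv ℝ (∇ f) x ξ, ξ⟫_ℝ ∧
      ⟪fderiv ℝ (∇ f) x ξ, ξ⟫_ℝ ≤ M * ‖ξ‖ ^ 2) (x y : H) :
    ν * ‖x - y‖ ^ 2 ≤ ⟪x - y, ∇ f x - ∇ f y⟫_ℝ := by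
  set d := x - y with hd
  have hline : ∀ θ : ℝ, HasDerivAt (fun θ : ℝ => y + θ • d) d θ := fun θ => by
    simpa using ((hasDerivAt_id θ).smul_const d).const_add y
  have hder : ∀ θ : ℝ, HasDerivAt (fun θ : ℝ => ⟪∇ f (y + θ • d), d⟫_ℝ)
      ⟪fderiv ℝ (∇ f) (y + θ • d) d, d⟫_ℝ θ := fun θ => by
    have h1 := ((hf.gradient.differentiable one_ne_zero) (y + θ • d)).hasFDerivAt.comp_hasDerivAt θ
      (hline θ)
    simpa using h1.inner ℝ (hasDerivAt_const θ d)
  obtain ⟨c, -, hc⟩ := exists_hasDerivAt_eq_slope _ _ one_pos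
    (fun θ _ => (hder θ).continuousAt.continuousWithinAt) (fun θ _ => hder θ)
  have h2 := (hess (y + c • d) d).1
  rw [hc] at h2
  have h3 : y + (1 : ℝ) • d = x := by rw [hd]; simp
  rw [h3] at h2
  simp only [zero_smul, add_zero, sub_zero, div_one, ← inner_sub_left] at h2
  rwa [real_inner_comm]

end Gradient

/-! ### A priori estimates for the forward-backward system -/

section APriori

variable {H : Type*} [NormedAddCommGroup H] [InnerProductSpace ℝ H] [CompleteSpace H]

/-- The properties of the coefficients on which the analysis of the forward-backward system rests.
The bounds on the Hessians of the costs enter through the strong monotonicity and the Lipschitz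
continuity of the gradients. -/
structure FBHypotheses (A : H → H) (K : H →L[ℝ] H) (F FT : H → ℝ)
    (γ b ν M νT MT m k T : ℝ) : Prop where
  T_pos : 0 < T
  drift_zero : A 0 = 0
  drift_diff : Differentiable ℝ A
  drift_diff2 : Differentiable ℝ (fderiv ℝ A)
  drift_bound : ∀ x, ‖fderiv ℝ A x‖ ≤ γ
  drift_lip : ∀ x₁ x₂, ‖fderiv ℝ A x₁ - fderiv ℝ A x₂‖ ≤ b * ‖x₁ - x₂‖ / (1 + max ‖x₁‖ ‖x₂‖)
  b_nonneg : 0 ≤ b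
  grad_diff : Differentiable ℝ (∇ F)
  grad_zero : ∇ F 0 = 0
  grad_mono : ∀ x y, ν * ‖x - y‖ ^ 2 ≤ ⟪x - y, ∇ F x - ∇ F y⟫_ℝ
  grad_lip : ∀ x y, ‖∇ F x - ∇ F y‖ ≤ M * ‖x - y‖
  M_nonneg : 0 ≤ M
  gradT_diff : Differentiable ℝ (∇ FT)
  gradT_zero : ∇ FT 0 = 0
  gradT_mono : ∀ x y, νT * ‖x - y‖ ^ 2 ≤ ⟪x - y, ∇ FT x - ∇ FT y⟫_ℝ
  gradT_lip : ∀ x y, ‖∇ FT x - ∇ FT y‖ ≤ MT * ‖x - y‖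
  νT_pos : 0 < νT
  MT_pos : 0 < MT
  control_coercive : ∀ ξ, m * ‖ξ‖ ^ 2 ≤ ⟪K ξ, ξ⟫_ℝ
  k_pos : 0 < k
  k_lt_m : k < m
  k_lt_ν : k < ν
  b_small : b ^ 2 / 16 < (m - k) * (ν - k)
  alpha_small : 0 < ν - b * alphaCoeff γ M MT νT k T 0

theorem IsFBSolution.restrict {A : H → H} {K : H →L[ℝ] H} {F FT : H → ℝ} {t T : ℝ} {x : H}
    {y z : ℝ → H} (h : IsFBSolution A K F FT t T x y z) {s : ℝ} (hs : t ≤ s) :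
    IsFBSolution A K F FT s T (y s) y z where
  continuousOn_y := h.continuousOn_y.mono (Icc_subset_Icc_left hs)
  continuousOn_z := h.continuousOn_z.mono (Icc_subset_Icc_left hs)
  forward r hr := h.forward r ⟨hs.trans_lt hr.1, hr.2⟩
  backward r hr := h.backward r ⟨hs.trans_lt hr.1, hr.2⟩
  initial := rfl
  final := h.final

namespace FBHypotheses

variable {A : H → H} {K : H →L[ℝ] H} {F FT : H → ℝ} {γ b ν M νT MT m k T : ℝ}

theorem norm_adjoint_le (h : FBHypotheses A K F FT γ b ν M νT MT m k T) (x z : H) :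
    ‖ContinuousLinearMap.adjoint (fderiv ℝ A x) z‖ ≤ γ * ‖z‖ := by
  refine (ContinuousLinearMap.le_opNorm _ _).trans ?_
  rw [LinearIsometryEquiv.norm_map]
  gcongr
  exact h.drift_bound x

theorem norm_adjoint_sub_le (h : FBHypotheses A K F FT γ b ν M νT MT m k T) {a : ℝ} (x y : H)
    {z : H} (ha : 0 ≤ a) (hz : ‖z‖ ≤ a * (1 + ‖y‖)) :
    ‖ContinuousLinearMap.adjoint (fderiv ℝ A x) z - ContinuousLinearMap.adjoint (fderiv ℝ A y) z‖
      ≤ b * a * ‖x - y‖ := by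
  have hb := h.b_nonneg
  rw [← sub_apply, ← map_sub]
  refine (ContinuousLinearMap.le_opNorm _ _).trans ?_
  rw [LinearIsometryEquiv.norm_map]
  have h1 : (0 : ℝ) < 1 + max ‖x‖ ‖y‖ := by
    have := le_max_left ‖x‖ ‖y‖
    linarith [norm_nonneg x]
  have h2 : ‖z‖ ≤ a * (1 + max ‖x‖ ‖y‖) := hz.trans (by gcongr; exact le_max_right _ _)
  calc _ ≤ b * ‖x - y‖ / (1 + max ‖x‖ ‖y‖) * (a * (1 + max ‖x‖ ‖y‖)) := by
        gcongr
        exact h.drift_lip x y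
    _ = _ := by field_simp

theorem alpha_pos (h : FBHypotheses A K F FT γ b ν M νT MT m k T) :
    0 < alphaCoeff γ M MT νT k T 0 :=
  alphaCoeff_pos h.k_pos h.νT_pos h.MT_pos h.T_pos.le

theorem norm_drift_sub_le (h : FBHypotheses A K F FT γ b ν M νT MT m k T) (x y : H) :
    ‖A x - A y‖ ≤ γ * ‖x - y‖ :=
  convex_univ.norm_image_sub_le_of_norm_fderiv_le (𝕜 := ℝ) (fun z _ => h.drift_diff z)
    (fun z _ => h.drift_bound z) (mem_univ y) (mem_univ x)

/-- Along a solution of the forward-backward system `z` is dominated by `y`. This compensates for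
the linear growth in `z` of the Lipschitz constant of `y ↦ (DA y)* z`. -/
theorem norm_backward_le (h : FBHypotheses A K F FT γ b ν M νT MT m k T) {t : ℝ} (ht : t ∈ Icc 0 T)
    {x : H} {y z : ℝ → H} (hyz : IsFBSolution A K F FT t T x y z) {s : ℝ} (hs : s ∈ Icc t T) :
    ‖z s‖ ≤ alphaCoeff γ M MT νT k T 0 * ‖y s‖ := by
  refine ((energy_estimates (γ := γ) (M := M) ht.2 h.k_pos h.νT_pos h.MT_pos hyz.continuousOn_y
    hyz.continuousOn_z hyz.forward hyz.backward ?_ ?_ ?_ ?_).1 s hs).trans ?_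
  · intro s hs
    have hb := h.b_nonneg
    have h1 := norm_taylor_remainder_le h.drift_diff h.b_nonneg h.drift_lip (y s) 0
    rw [h.drift_zero, zero_sub, zero_sub, map_neg, sub_neg_eq_add, norm_neg] at h1
    have h2 : b / 2 * ‖y s‖ ^ 2 / (1 + ‖y s‖) ≤ b / 2 * ‖y s‖ := by
      rw [div_le_iff₀ (by positivity)]
      have : 0 ≤ b / 2 * ‖y s‖ := by positivity
      nlinarith
    have h3 : ⟪A (y s) - fderiv ℝ A (y s) (y s), z s⟫_ℝ ≤ b / 2 * ‖y s‖ * ‖z s‖ := by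
      refine (real_inner_le_norm _ _).trans ?_
      gcongr
      rw [← norm_neg]
      refine le_trans (le_of_eq ?_) (h1.trans h2)
      congr 1; abel
    have h4 := h.control_coercive (z s)
    have h5 := h.grad_mono (y s) 0
    rw [h.grad_zero, sub_zero, sub_zero] at h5
    have h6 : ⟪A (y s) - K (z s), z s⟫_ℝ
        + ⟪y s, -(ContinuousLinearMap.adjoint (fderiv ℝ A (y s)) (z s) + ∇ F (y s))⟫_ℝ
        = ⟪A (y s) - fderiv ℝ A (y s) (y s), z s⟫_ℝ - ⟪K (z s), z s⟫_ℝ - ⟪y s, ∇ F (y s)⟫_ℝ := by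
      rw [inner_neg_right, inner_add_right, ContinuousLinearMap.adjoint_inner_right,
        inner_sub_left, inner_sub_left]
      ring
    rw [h6]
    -- the quadratic form with coefficients `m - k`, `ν - k` and `b / 2` is nonnegative
    have h7 : b / 2 * ‖y s‖ * ‖z s‖ ≤ (ν - k) * ‖y s‖ ^ 2 + (m - k) * ‖z s‖ ^ 2 := by
      have hm := sub_pos.2 h.k_lt_m
      have h8 : 0 ≤ ((m - k) * ‖z s‖ - b / 4 * ‖y s‖) ^ 2 := sq_nonneg _
      have h9 : 0 ≤ ((m - k) * (ν - k) - b ^ 2 / 16) * ‖y s‖ ^ 2 :=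
        mul_nonneg (sub_nonneg.2 h.b_small.le) (sq_nonneg _)
      refine le_of_mul_le_mul_left ?_ hm
      nlinarith
    linarith
  · intro s hs
    rw [norm_neg]
    refine (norm_add_le _ _).trans (add_le_add (h.norm_adjoint_le _ _) ?_)
    simpa [h.grad_zero] using h.grad_lip (y s) 0
  · rw [hyz.final]
    simpa [h.gradT_zero] using h.gradT_mono (y T) 0
  · rw [hyz.final]
    simpa [h.gradT_zero] using h.gradT_lip (y T) 0
  · gcongr
    exact alphaCoeff_le h.k_pos (ht.1.trans hs.1)

/-- Two solutions of the forward-backward system satisfy the energy estimates: the bound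
`‖z‖ ≤ α ‖y‖` makes the system monotone, with the constant `ν - b α` in the variable `y`. -/
theorem exists_comparison (h : FBHypotheses A K F FT γ b ν M νT MT m k T) :
    ∃ β : ℝ, 0 < β ∧ ∀ t ∈ Icc 0 T, ∀ (x₁ x₂ : H) (y₁ z₁ y₂ z₂ : ℝ → H),
      IsFBSolution A K F FT t T x₁ y₁ z₁ → IsFBSolution A K F FT t T x₂ y₂ z₂ →
      (∀ s ∈ Icc t T, ‖z₁ s - z₂ s‖ ≤ β * ‖y₁ s - y₂ s‖) ∧
      νT * ‖y₁ T - y₂ T‖ ^ 2 ≤ β * ‖x₁ - x₂‖ ^ 2 ∧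
      (x₁ = x₂ → EqOn y₁ y₂ (Icc t T) ∧ EqOn z₁ z₂ (Icc t T)) := by
  set α := alphaCoeff γ M MT νT k T 0 with hα
  have hαpos : 0 < α := h.alpha_pos
  have hb := h.b_nonneg
  set κ := min m (ν - b * α) with hκdef
  have hκ : 0 < κ := lt_min (h.k_pos.trans h.k_lt_m) h.alpha_small
  refine ⟨alphaCoeff γ (b * α + M) MT νT κ T 0, alphaCoeff_pos hκ h.νT_pos h.MT_pos h.T_pos.le, ?_⟩
  intro t ht x₁ x₂ y₁ z₁ y₂ z₂ h₁ h₂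
  have hdiss : ∀ s ∈ Ioo t T,
      ⟪A (y₁ s) - K (z₁ s) - (A (y₂ s) - K (z₂ s)), z₁ s - z₂ s⟫_ℝ
        + ⟪y₁ s - y₂ s, -(ContinuousLinearMap.adjoint (fderiv ℝ A (y₁ s)) (z₁ s) + ∇ F (y₁ s))
          - -(ContinuousLinearMap.adjoint (fderiv ℝ A (y₂ s)) (z₂ s) + ∇ F (y₂ s))⟫_ℝ
        ≤ -κ * (‖y₁ s - y₂ s‖ ^ 2 + ‖z₁ s - z₂ s‖ ^ 2) := by
    intro s hs
    have hs' := Ioo_subset_Icc_self hs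
    have hz₁ := h.norm_backward_le ht h₁ hs'
    have hz₂ := h.norm_backward_le ht h₂ hs'
    set d := y₁ s - y₂ s with hd
    set e := z₁ s - z₂ s with he
    -- each Taylor remainder of the drift is paired with a dominated backward variable
    have hrem : ∀ u v w : H, ‖w‖ ≤ α * ‖u‖ →
        ⟪w, A v - A u - fderiv ℝ A u (v - u)⟫_ℝ ≥ -(b * α / 2 * ‖v - u‖ ^ 2) := by
      intro u v w hw
      have h1 := norm_taylor_remainder_le h.drift_diff hb h.drift_lip u v
      have h2 := (abs_le.1 (abs_real_inner_le_norm w (A v - A u - fderiv ℝ A u (v - u)))).1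
      have h3 : ‖w‖ * ‖A v - A u - fderiv ℝ A u (v - u)‖
          ≤ α * (1 + ‖u‖) * (b / 2 * ‖v - u‖ ^ 2 / (1 + ‖u‖)) := by
        gcongr
        exact hw.trans (by gcongr; linarith)
      have h4 : α * (1 + ‖u‖) * (b / 2 * ‖v - u‖ ^ 2 / (1 + ‖u‖)) = b * α / 2 * ‖v - u‖ ^ 2 := by
        field_simp
      linarith
    have r₁ := hrem (y₁ s) (y₂ s) (z₁ s) hz₁
    have r₂ := hrem (y₂ s) (y₁ s) (z₂ s) hz₂
    rw [← norm_neg, neg_sub, ← hd] at r₁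
    rw [← hd] at r₂
    have h5 := h.control_coercive e
    have h6 := h.grad_mono (y₁ s) (y₂ s)
    rw [← hd] at h6
    have h7 : y₂ s - y₁ s = -d := by rw [hd]; abel
    rw [h7] at r₁
    have h8 : ⟪A (y₁ s) - K (z₁ s) - (A (y₂ s) - K (z₂ s)), e⟫_ℝ
        + ⟪d, -(ContinuousLinearMap.adjoint (fderiv ℝ A (y₁ s)) (z₁ s) + ∇ F (y₁ s))
          - -(ContinuousLinearMap.adjoint (fderiv ℝ A (y₂ s)) (z₂ s) + ∇ F (y₂ s))⟫_ℝ
        = -⟪z₁ s, A (y₂ s) - A (y₁ s) - fderiv ℝ A (y₁ s) (-d)⟫_ℝ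
          - ⟪z₂ s, A (y₁ s) - A (y₂ s) - fderiv ℝ A (y₂ s) d⟫_ℝ
          - ⟪K e, e⟫_ℝ - ⟪d, ∇ F (y₁ s) - ∇ F (y₂ s)⟫_ℝ := by
      have h9 : A (y₁ s) - K (z₁ s) - (A (y₂ s) - K (z₂ s)) = A (y₁ s) - A (y₂ s) - K e := by
        rw [he, map_sub]; abel
      rw [h9, map_neg]
      simp only [inner_sub_left, inner_sub_right, inner_neg_left, inner_neg_right, inner_add_right,
        ContinuousLinearMap.adjoint_inner_right, real_inner_comm _ (z₁ s),
        real_inner_comm _ (z₂ s)]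
      rw [he]
      simp only [inner_sub_right]
      ring
    rw [h8]
    have h10 : κ * ‖d‖ ^ 2 ≤ (ν - b * α) * ‖d‖ ^ 2 := by gcongr; exact min_le_right _ _
    have h11 : κ * ‖e‖ ^ 2 ≤ m * ‖e‖ ^ 2 := by gcongr; exact min_le_left _ _
    linarith
  have hgrowth : ∀ s ∈ Ioo t T,
      ‖-(ContinuousLinearMap.adjoint (fderiv ℝ A (y₁ s)) (z₁ s) + ∇ F (y₁ s))
        - -(ContinuousLinearMap.adjoint (fderiv ℝ A (y₂ s)) (z₂ s) + ∇ F (y₂ s))‖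
        ≤ γ * ‖z₁ s - z₂ s‖ + (b * α + M) * ‖y₁ s - y₂ s‖ := by
    intro s hs
    have hz₂ := h.norm_backward_le ht h₂ (Ioo_subset_Icc_self hs)
    have h1 : -(ContinuousLinearMap.adjoint (fderiv ℝ A (y₁ s)) (z₁ s) + ∇ F (y₁ s))
          - -(ContinuousLinearMap.adjoint (fderiv ℝ A (y₂ s)) (z₂ s) + ∇ F (y₂ s))
        = -(ContinuousLinearMap.adjoint (fderiv ℝ A (y₁ s)) (z₁ s - z₂ s)
          + ((ContinuousLinearMap.adjoint (fderiv ℝ A (y₁ s)) (z₂ s)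
            - ContinuousLinearMap.adjoint (fderiv ℝ A (y₂ s)) (z₂ s))
          + (∇ F (y₁ s) - ∇ F (y₂ s)))) := by
      rw [map_sub]; abel
    rw [h1, norm_neg]
    have h2 := h.norm_adjoint_le (y₁ s) (z₁ s - z₂ s)
    have h3 := h.norm_adjoint_sub_le (y₁ s) (y₂ s) hαpos.le
      (hz₂.trans (mul_le_mul_of_nonneg_left (by linarith) hαpos.le))
    have h4 := h.grad_lip (y₁ s) (y₂ s)
    refine (norm_add_le _ _).trans (add_le_add h2 ((norm_add_le _ _).trans ?_))
    linarith
  obtain ⟨e1, e2, e3⟩ := energy_estimates (y := fun s => y₁ s - y₂ s) (z := fun s => z₁ s - z₂ s)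
    (γ := γ) (M := b * α + M) ht.2 hκ h.νT_pos h.MT_pos
    (h₁.continuousOn_y.sub h₂.continuousOn_y) (h₁.continuousOn_z.sub h₂.continuousOn_z)
    (fun s hs => (h₁.forward s hs).sub (h₂.forward s hs))
    (fun s hs => (h₁.backward s hs).sub (h₂.backward s hs)) hdiss hgrowth
    (by rw [h₁.final, h₂.final]; exact h.gradT_mono _ _)
    (by rw [h₁.final, h₂.final]; exact h.gradT_lip _ _)
  have hle : ∀ s, t ≤ s → alphaCoeff γ (b * α + M) MT νT κ T s
      ≤ alphaCoeff γ (b * α + M) MT νT κ T 0 := fun s hs => alphaCoeff_le hκ (ht.1.trans hs)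
  refine ⟨fun s hs => (e1 s hs).trans (by gcongr; exact hle s hs.1), ?_, fun hx => ?_⟩
  · rw [h₁.initial, h₂.initial] at e2
    exact e2.trans (by gcongr; exact hle t le_rfl)
  · have e4 := e3 (by rw [h₁.initial, h₂.initial, hx, sub_self])
    exact ⟨fun s hs => sub_eq_zero.1 (e4 s hs).1, fun s hs => sub_eq_zero.1 (e4 s hs).2⟩

end FBHypotheses

end APriori

/-! ### Characteristics issued from the final time -/

section Characteristics

variable {H : Type*} [NormedAddCommGroup H] [InnerProductSpace ℝ H]

/-- The radial projection of `z` onto the closed ball of radius `r > 0` about the origin. -/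
noncomputable def radialProj (r : ℝ) (z : H) : H := (r / max r ‖z‖) • z

theorem radialProj_of_norm_le {r : ℝ} (hr : 0 < r) {z : H} (hz : ‖z‖ ≤ r) : radialProj r z = z := by
  rw [radialProj, max_eq_left hz, div_self hr.ne', one_smul]

theorem norm_radialProj_le {r : ℝ} (hr : 0 < r) (z : H) : ‖radialProj r z‖ ≤ r := by
  have h1 : 0 < max r ‖z‖ := lt_max_of_lt_left hr
  rw [radialProj, norm_smul, Real.norm_of_nonneg (by positivity), div_mul_eq_mul_div,
    div_le_iff₀ h1]
  gcongr
  exact le_max_right _ _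

theorem norm_radialProj_sub_le {r₁ r₂ : ℝ} (hr₁ : 0 < r₁) (hr₂ : 0 < r₂) (z₁ z₂ : H) :
    ‖radialProj r₁ z₁ - radialProj r₂ z₂‖ ≤ 2 * (‖z₁ - z₂‖ + |r₁ - r₂|) := by
  set m₁ := max r₁ ‖z₁‖ with hm₁
  set m₂ := max r₂ ‖z₂‖ with hm₂
  have h₁ : 0 < m₁ := lt_max_of_lt_left hr₁
  have h₂ : 0 < m₂ := lt_max_of_lt_left hr₂
  have hm : |m₁ - m₂| ≤ |r₁ - r₂| + ‖z₁ - z₂‖ := by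
    refine (abs_max_sub_max_le_max _ _ _ _).trans (max_le ?_ ?_)
    · linarith [norm_nonneg (z₁ - z₂)]
    · linarith [abs_norm_sub_norm_le z₁ z₂, abs_nonneg (r₁ - r₂)]
  have hc₁ : r₁ / m₁ ≤ 1 := (div_le_one h₁).2 (le_max_left _ _)
  have e1 : radialProj r₁ z₁ - radialProj r₂ z₂
      = (r₁ / m₁) • (z₁ - z₂) + (r₁ / m₁ - r₂ / m₂) • z₂ := by
    rw [radialProj, radialProj, ← hm₁, ← hm₂, smul_sub, sub_smul]; abel
  have e2 : (r₁ / m₁ - r₂ / m₂) * m₂ = (r₁ / m₁) * (m₂ - m₁) + (r₁ - r₂) := by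
    field_simp; ring
  have e3 : |r₁ / m₁ - r₂ / m₂| * ‖z₂‖ ≤ |m₁ - m₂| + |r₁ - r₂| := by
    calc |r₁ / m₁ - r₂ / m₂| * ‖z₂‖ ≤ |r₁ / m₁ - r₂ / m₂| * m₂ := by
          gcongr; exact le_max_right _ _
      _ = |(r₁ / m₁ - r₂ / m₂) * m₂| := by rw [abs_mul, abs_of_pos h₂]
      _ ≤ |r₁ / m₁| * |m₂ - m₁| + |r₁ - r₂| := by
          rw [e2, ← abs_mul]; exact abs_add_le _ _
      _ ≤ 1 * |m₂ - m₁| + |r₁ - r₂| := by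
          gcongr; rwa [abs_of_pos (by positivity)]
      _ = _ := by rw [one_mul, abs_sub_comm]
  rw [e1]
  refine (norm_add_le _ _).trans ?_
  rw [norm_smul, norm_smul, Real.norm_eq_abs, Real.norm_eq_abs, abs_of_pos (by positivity)]
  have e4 : r₁ / m₁ * ‖z₁ - z₂‖ ≤ ‖z₁ - z₂‖ := mul_le_of_le_one_left (norm_nonneg _) hc₁
  linarith

variable [CompleteSpace H]

/-- The vector field of the forward-backward system in reversed time. -/
noncomputable def reversedField (A : H → H) (K : H →L[ℝ] H) (F : H → ℝ) (p : H × H) : H × H :=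
  (K p.2 - A p.1, ContinuousLinearMap.adjoint (fderiv ℝ A p.1) p.2 + ∇ F p.1)

/-- The reversed field with `z` replaced, in the term `(DA(y))* z`, by its radial projection onto
the ball of radius `α (1 + ‖y‖)`. Unlike the original field it is globally Lipschitz. -/
noncomputable def truncatedField (A : H → H) (K : H →L[ℝ] H) (F : H → ℝ) (α : ℝ) (p : H × H) :
    H × H :=
  (K p.2 - A p.1, ContinuousLinearMap.adjoint (fderiv ℝ A p.1)
    (radialProj (α * (1 + ‖p.1‖)) p.2) + ∇ F p.1)

theorem truncatedField_of_norm_le {A : H → H} {K : H →L[ℝ] H} {F : H → ℝ} {α : ℝ} (hα : 0 < α)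
    {p : H × H} (hp : ‖p.2‖ ≤ α * (1 + ‖p.1‖)) :
    truncatedField A K F α p = reversedField A K F p := by
  rw [truncatedField, radialProj_of_norm_le (by positivity) hp, reversedField]

theorem isBoundedLinearMap_adjoint :
    IsBoundedLinearMap ℝ fun S : H →L[ℝ] H => ContinuousLinearMap.adjoint S where
  map_add x y := by simp
  map_smul c x := by simp
  bound := ⟨1, one_pos, fun x => by simp⟩

namespace FBHypotheses

variable {A : H → H} {K : H →L[ℝ] H} {F FT : H → ℝ} {γ b ν M νT MT m k T : ℝ}

theorem differentiable_reversedField (h : FBHypotheses A K F FT γ b ν M νT MT m k T) :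
    Differentiable ℝ (reversedField A K F) := by
  have h1 : Differentiable ℝ fun p : H × H => ContinuousLinearMap.adjoint (fderiv ℝ A p.1) :=
    (isBoundedLinearMap_adjoint (H := H)).differentiable.comp
      (h.drift_diff2.comp differentiable_fst)
  refine Differentiable.prodMk ?_ ((h1.clm_apply differentiable_snd).add
    (h.grad_diff.comp differentiable_fst))
  exact (K.differentiable.comp differentiable_snd).sub (h.drift_diff.comp differentiable_fst)

theorem differentiableAt_truncatedField (h : FBHypotheses A K F FT γ b ν M νT MT m k T) {α : ℝ}
    (hα : 0 < α) {p : H × H} (hp : ‖p.2‖ < α * (1 + ‖p.1‖)) :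
    DifferentiableAt ℝ (truncatedField A K F α) p := by
  refine (h.differentiable_reversedField p).congr_of_eventuallyEq ?_
  have hopen : IsOpen {q : H × H | ‖q.2‖ < α * (1 + ‖q.1‖)} :=
    isOpen_lt (by fun_prop) (by fun_prop)
  filter_upwards [hopen.mem_nhds hp] with q hq
  exact truncatedField_of_norm_le hα (le_of_lt hq)

theorem exists_lipschitzWith_truncatedField (h : FBHypotheses A K F FT γ b ν M νT MT m k T) {α : ℝ}
    (hα : 0 < α) : ∃ L, LipschitzWith L (truncatedField A K F α) := by
  have hγ : 0 ≤ γ := (norm_nonneg _).trans (h.drift_bound 0)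
  have hb := h.b_nonneg
  have hM := h.M_nonneg
  refine ⟨(‖K‖ + γ + (γ * (2 * (1 + α)) + b * α + M)).toNNReal,
    LipschitzWith.of_dist_le_mul fun p q => ?_⟩
  rw [Real.coe_toNNReal _ (by positivity), dist_eq_norm, dist_eq_norm]
  have hfst : ‖p.1 - q.1‖ ≤ ‖p - q‖ := norm_fst_le (p - q)
  have hsnd : ‖p.2 - q.2‖ ≤ ‖p - q‖ := norm_snd_le (p - q)
  set d := ‖p - q‖ with hd
  have hd0 : 0 ≤ d := norm_nonneg _
  set w₁ := radialProj (α * (1 + ‖p.1‖)) p.2 with hw₁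
  set w₂ := radialProj (α * (1 + ‖q.1‖)) q.2 with hw₂
  have hw : ‖w₁ - w₂‖ ≤ 2 * (1 + α) * d := by
    refine (norm_radialProj_sub_le (by positivity) (by positivity) _ _).trans ?_
    have h1 : |α * (1 + ‖p.1‖) - α * (1 + ‖q.1‖)| ≤ α * d := by
      rw [← mul_sub, add_sub_add_left_eq_sub, abs_mul, abs_of_pos hα]
      gcongr
      exact (abs_norm_sub_norm_le _ _).trans hfst
    linarith
  have e1 : ‖K (p.2 - q.2) - (A p.1 - A q.1)‖ ≤ (‖K‖ + γ) * d := by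
    refine (norm_sub_le _ _).trans ?_
    have h1 : ‖K (p.2 - q.2)‖ ≤ ‖K‖ * d := (K.le_opNorm _).trans (by gcongr)
    have h2 : ‖A p.1 - A q.1‖ ≤ γ * d := (h.norm_drift_sub_le _ _).trans (by gcongr)
    linarith
  have e2 : ‖ContinuousLinearMap.adjoint (fderiv ℝ A p.1) (w₁ - w₂)
      + ((ContinuousLinearMap.adjoint (fderiv ℝ A p.1) w₂
        - ContinuousLinearMap.adjoint (fderiv ℝ A q.1) w₂) + (∇ F p.1 - ∇ F q.1))‖
      ≤ (γ * (2 * (1 + α)) + b * α + M) * d := by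
    have h1 : ‖ContinuousLinearMap.adjoint (fderiv ℝ A p.1) (w₁ - w₂)‖ ≤ γ * (2 * (1 + α) * d) :=
      (h.norm_adjoint_le _ _).trans (by gcongr)
    have h2 := (h.norm_adjoint_sub_le p.1 q.1 hα.le
      (norm_radialProj_le (by positivity) q.2)).trans
      (mul_le_mul_of_nonneg_left hfst (by positivity))
    have h3 : ‖∇ F p.1 - ∇ F q.1‖ ≤ M * d := (h.grad_lip _ _).trans (by gcongr)
    refine (norm_add_le _ _).trans ((add_le_add h1 ((norm_add_le _ _).trans
      (add_le_add h2 h3))).trans (le_of_eq (by ring)))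
  have e3 : truncatedField A K F α p - truncatedField A K F α q
      = (K (p.2 - q.2) - (A p.1 - A q.1),
        ContinuousLinearMap.adjoint (fderiv ℝ A p.1) (w₁ - w₂)
      + ((ContinuousLinearMap.adjoint (fderiv ℝ A p.1) w₂
        - ContinuousLinearMap.adjoint (fderiv ℝ A q.1) w₂) + (∇ F p.1 - ∇ F q.1))) := by
    simp only [truncatedField, ← hw₁, ← hw₂]
    ext
    · simp; abel
    · simp; abel
  rw [e3]
  refine max_le (e1.trans ?_) (e2.trans ?_)
  · have : 0 ≤ (γ * (2 * (1 + α)) + b * α + M) * d := by positivity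
    linarith
  · have : 0 ≤ (‖K‖ + γ) * d := by positivity
    linarith

/-- The solutions of the forward-backward system on `[0, T]` form a family parametrized by the final
value `η` of `y`: the final condition prescribes `z T`, and the system is solved backwards in time.
The a priori bound keeps these solutions in the region where the truncation is inactive, as one
sees at the first time, going backwards from `T`, at which it would become active. -/
theorem exists_characteristics (h : FBHypotheses A K F FT γ b ν M νT MT m k T) :
    ∃ (X : H → ℝ → H × H) (C : ℝ), 0 ≤ C ∧
      (∀ η, IsFBSolution A K F FT 0 T (X η 0).1 (fun s => (X η s).1) fun s => (X η s).2) ∧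
      (∀ η, (X η T).1 = η) ∧
      (∀ η, Continuous (X η)) ∧
      (∀ η, ∀ s ∈ Ioo 0 T, HasDerivAt (X η) (-reversedField A K F (X η s)) s) ∧
      (∀ η η', ∀ s ∈ Icc 0 T, ∀ s' ∈ Icc 0 T,
        ‖(X η s' - X η' s') - (X η s - X η' s)‖ ≤ C * |s' - s| * ‖η - η'‖) ∧
      ∀ s, Differentiable ℝ fun η => X η s := by
  set α := alphaCoeff γ M MT νT k T 0 with hα
  have hαpos : 0 < α := h.alpha_pos
  have hMT := h.MT_pos
  obtain ⟨L, hL⟩ := h.exists_lipschitzWith_truncatedField hαpos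
  obtain ⟨φ, C, hcont, hinit, hder, -, hinc, hdiff⟩ := exists_flow_of_lipschitzWith hL h.T_pos.le
  set X : H → ℝ → H × H := fun η s => φ (η, ∇ FT η) (T - s) with hX
  have hXcont : ∀ η, Continuous (X η) := fun η => (hcont _).comp (by fun_prop)
  have hXT : ∀ η, X η T = (η, ∇ FT η) := fun η => by rw [hX]; simp [hinit]
  have hXder : ∀ η, ∀ s ∈ Ioo 0 T, ‖(X η s).2‖ ≤ α * (1 + ‖(X η s).1‖) →
      HasDerivAt (X η) (-reversedField A K F (X η s)) s := fun η s hs hcone => by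
    rw [← truncatedField_of_norm_le hαpos hcone]
    exact HasDerivAt.comp_const_sub T s
      (hder (η, ∇ FT η) (T - s) ⟨by linarith [hs.2], by linarith [hs.1]⟩)
  have hsol : ∀ η, ∀ t ∈ Icc 0 T, (∀ s ∈ Ioo t T, ‖(X η s).2‖ ≤ α * (1 + ‖(X η s).1‖)) →
      IsFBSolution A K F FT t T (X η t).1 (fun s => (X η s).1) fun s => (X η s).2 := by
    intro η t ht hcone
    have hd : ∀ s ∈ Ioo t T, HasDerivAt (X η) (-reversedField A K F (X η s)) s := fun s hs =>
      hXder η s ⟨ht.1.trans_lt hs.1, hs.2⟩ (hcone s hs)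
    have hc := hXcont η
    refine ⟨by fun_prop, by fun_prop, fun s hs => ?_, fun s hs => ?_, rfl, ?_⟩
    · have := (hasFDerivAt_fst (𝕜 := ℝ) (p := X η s)).comp_hasDerivAt s (hd s hs)
      exact this.congr_deriv (by simp [reversedField])
    · have := (hasFDerivAt_snd (𝕜 := ℝ) (p := X η s)).comp_hasDerivAt s (hd s hs)
      exact this.congr_deriv (by simp [reversedField])
    · simp only [hXT]
  have hcone : ∀ η, ∀ s ∈ Icc 0 T, ‖(X η s).2‖ < α * (1 + ‖(X η s).1‖) := by
    intro η
    by_contra! hbad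
    have hc := hXcont η
    -- the last time before `T` at which the bound fails
    set S := {s | s ∈ Icc 0 T ∧ α * (1 + ‖(X η s).1‖) ≤ ‖(X η s).2‖} with hS
    have hSc : IsCompact S := isCompact_Icc.inter_right
      (isClosed_le (f := fun s => α * (1 + ‖(X η s).1‖)) (g := fun s => ‖(X η s).2‖)
        (by fun_prop) (by fun_prop))
    obtain ⟨s, ⟨hs, hs_bad⟩, hs_max⟩ := hSc.exists_isGreatest hbad
    have h1 := hsol η s hs fun r hr => by
      by_contra! hr_bad
      exact absurd (hs_max ⟨⟨hs.1.trans hr.1.le, hr.2.le⟩, hr_bad.le⟩) (not_le.2 hr.1)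
    have h2 := h.norm_backward_le hs h1 (left_mem_Icc.2 hs.2)
    rw [← hα] at h2
    linarith
  have hι : ∀ η η', ‖(η, ∇ FT η) - (η', ∇ FT η')‖ ≤ (1 + MT) * ‖η - η'‖ := fun η η' => by
    have h1 := h.gradT_lip η η'
    have h2 : 0 ≤ MT * ‖η - η'‖ := by positivity
    exact max_le (by simp only [Prod.mk_sub_mk]; linarith)
      (by simp only [Prod.mk_sub_mk]; linarith [norm_nonneg (η - η')])
  refine ⟨X, C * (1 + MT), by positivity, fun η => ?_, fun η => by rw [hXT], hXcont, ?_, ?_, ?_⟩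
  · exact hsol η 0 ⟨le_rfl, h.T_pos.le⟩ fun s hs => (hcone η s (Ioo_subset_Icc_self hs)).le
  · exact fun η s hs => hXder η s hs (hcone η s (Ioo_subset_Icc_self hs)).le
  · intro η η' s hs s' hs'
    have h1 := hinc (η, ∇ FT η) (η', ∇ FT η') (T - s) ⟨by linarith [hs.2], by linarith [hs.1]⟩
      (T - s') ⟨by linarith [hs'.2], by linarith [hs'.1]⟩
    rw [sub_sub_sub_cancel_left, abs_sub_comm] at h1
    refine h1.trans ?_
    calc _ ≤ C * |s' - s| * ((1 + MT) * ‖η - η'‖) := by gcongr; exact hι η η'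
      _ = _ := by ring
  · intro s η
    refine DifferentiableAt.comp η (g := fun p : H × H => φ p (T - s))
      (hdiff (η, ∇ FT η) (fun r hr => ?_) (T - s))
      (differentiableAt_id.prodMk (h.gradT_diff η))
    have h1 := hcone η (T - r) ⟨by linarith [hr.2], by linarith [hr.1]⟩
    simp only [hX, sub_sub_cancel] at h1
    exact h.differentiableAt_truncatedField hαpos h1

end FBHypotheses

end Characteristics

/-! ### The decoupling field -/

section Decoupling

variable {H : Type*} [NormedAddCommGroup H] [InnerProductSpace ℝ H]

/-- The first order expansion in time of the characteristics is locally uniform in the point at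
which they are started. -/
theorem characteristic_expansion {X : H → ℝ → H × H} {C T : ℝ}
    (hinc : ∀ η η', ∀ s ∈ Icc 0 T, ∀ s' ∈ Icc 0 T,
        ‖(X η s' - X η' s') - (X η s - X η' s)‖ ≤ C * |s' - s| * ‖η - η'‖)
    {σ : H → H} (hσ : Continuous σ) {x v : H} {w : H × H} {t : ℝ} (ht : t ∈ Ioo 0 T)
    (hder : HasDerivAt (X (σ x)) w t) :
    (fun p : H × ℝ => X (σ (p.1 - (p.2 - t) • v)) p.2 - X (σ (p.1 - (p.2 - t) • v)) t
      - (p.2 - t) • w) =o[𝓝 (x, t)] fun p => p - (x, t) := by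
  have hsnd : (fun p : H × ℝ => p.2 - t) =O[𝓝 (x, t)] fun p => p - (x, t) :=
    Asymptotics.IsBigO.of_bound 1 (Eventually.of_forall fun p => by
      rw [one_mul]; exact norm_snd_le (p - (x, t)))
  have hsnd_tendsto : Tendsto (fun p : H × ℝ => p.2) (𝓝 (x, t)) (𝓝 t) :=
    continuous_snd.continuousAt
  have h1 : (fun p : H × ℝ => X (σ x) p.2 - X (σ x) t - (p.2 - t) • w)
      =o[𝓝 (x, t)] fun p => p - (x, t) :=
    ((hasDerivAt_iff_isLittleO.1 hder).comp_tendsto hsnd_tendsto).trans_isBigO hsnd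
  have hσ0 : Tendsto (fun p : H × ℝ => σ (p.1 - (p.2 - t) • v) - σ x) (𝓝 (x, t)) (𝓝 0) := by
    have hc : Continuous fun p : H × ℝ => σ (p.1 - (p.2 - t) • v) - σ x := by fun_prop
    have := hc.tendsto (x, t)
    simpa using this
  have h2 : (fun p : H × ℝ => (X (σ (p.1 - (p.2 - t) • v)) p.2 - X (σ x) p.2)
      - (X (σ (p.1 - (p.2 - t) • v)) t - X (σ x) t)) =o[𝓝 (x, t)] fun p => p - (x, t) := by
    have h3 : (fun p : H × ℝ => ‖p.2 - t‖ * ‖σ (p.1 - (p.2 - t) • v) - σ x‖)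
        =o[𝓝 (x, t)] fun p => p - (x, t) := by
      have := hsnd.norm_norm.mul_isLittleO
        ((Asymptotics.isLittleO_one_iff ℝ).2 hσ0).norm_left
      simpa using this
    refine (Asymptotics.IsBigO.of_bound C ?_).trans_isLittleO h3
    have hmem : ∀ᶠ p : H × ℝ in 𝓝 (x, t), p.2 ∈ Icc 0 T :=
      continuous_snd.continuousAt.eventually (Icc_mem_nhds ht.1 ht.2)
    filter_upwards [hmem] with p hp
    refine (hinc _ _ t (Ioo_subset_Icc_self ht) p.2 hp).trans (le_of_eq ?_)
    rw [Real.norm_of_nonneg (by positivity), Real.norm_eq_abs, mul_assoc]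
  refine (h2.add h1).congr_left fun p => ?_
  abel

/-- If the characteristic through `(x, t)` has velocity `(v, w)`, then the field is differentiable
in `(x, t)`, and its time derivative is `w - DₓΓ v`. -/
theorem hasFDerivAt_field {Γ : H → ℝ → H} {X : H → ℝ → H × H} {σ : H → ℝ → H} {C β T : ℝ}
    (hinc : ∀ η η', ∀ s ∈ Icc 0 T, ∀ s' ∈ Icc 0 T,
        ‖(X η s' - X η' s') - (X η s - X η' s)‖ ≤ C * |s' - s| * ‖η - η'‖)
    (hΓlip : ∀ t ∈ Icc 0 T, ∀ x x', ‖Γ x t - Γ x' t‖ ≤ β * ‖x - x'‖)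
    (hΓX : ∀ η, ∀ s ∈ Icc 0 T, Γ (X η s).1 s = (X η s).2) {x : H} {t : ℝ} (ht : t ∈ Ioo 0 T)
    (hσX : ∀ x, (X (σ x t) t).1 = x) (hσ : Continuous fun x => σ x t) {v w : H}
    (hder : HasDerivAt (X (σ x t)) (v, w) t)
    (hdiff : DifferentiableAt ℝ (fun x => Γ x t) x) :
    HasFDerivAt (fun p : H × ℝ => Γ p.1 p.2)
      ((fderiv ℝ (fun x => Γ x t) x).comp (ContinuousLinearMap.fst ℝ H ℝ)
        + (ContinuousLinearMap.snd ℝ H ℝ).smulRight (w - fderiv ℝ (fun x => Γ x t) x v))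
      (x, t) := by
  have ht' := Ioo_subset_Icc_self ht
  set D := fderiv ℝ (fun x => Γ x t) x with hD
  set ξ : H × ℝ → H := fun p => p.1 - (p.2 - t) • v with hξ
  have hexp := characteristic_expansion (v := v) hinc hσ ht hder
  have hfst : (fun p : H × ℝ => (X (σ (ξ p) t) p.2).1 - ξ p - (p.2 - t) • v)
      =o[𝓝 (x, t)] fun p => p - (x, t) := by
    refine (Asymptotics.IsBigO.of_bound 1 (Eventually.of_forall fun p => ?_)).trans_isLittleO hexp
    rw [one_mul]
    refine le_trans (le_of_eq ?_) (norm_fst_le _)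
    simp [hσX, hξ]
  have hsnd : (fun p : H × ℝ => (X (σ (ξ p) t) p.2).2 - Γ (ξ p) t - (p.2 - t) • w)
      =o[𝓝 (x, t)] fun p => p - (x, t) := by
    refine (Asymptotics.IsBigO.of_bound 1 (Eventually.of_forall fun p => ?_)).trans_isLittleO hexp
    rw [one_mul]
    refine le_trans (le_of_eq ?_) (norm_snd_le _)
    have h1 := hΓX (σ (ξ p) t) t ht'
    rw [hσX] at h1
    rw [h1]
    simp [hξ]
  have hξ_tendsto : Tendsto ξ (𝓝 (x, t)) (𝓝 x) := by
    have hc : Continuous ξ := by fun_prop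
    simpa [hξ] using hc.tendsto (x, t)
  have hξ_big : (fun p => ξ p - x) =O[𝓝 (x, t)] fun p => p - (x, t) := by
    refine Asymptotics.IsBigO.of_bound (1 + ‖v‖) (Eventually.of_forall fun p => ?_)
    have h1 : ‖p.1 - x‖ ≤ ‖p - (x, t)‖ := norm_fst_le (p - (x, t))
    have h2 : ‖p.2 - t‖ ≤ ‖p - (x, t)‖ := norm_snd_le (p - (x, t))
    have h3 : ξ p - x = (p.1 - x) - (p.2 - t) • v := by simp only [hξ]; abel
    rw [h3]
    refine (norm_sub_le _ _).trans ?_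
    rw [norm_smul, add_mul, one_mul, mul_comm ‖v‖]
    gcongr
  have hspace : (fun p => Γ (ξ p) t - Γ x t - D (ξ p - x)) =o[𝓝 (x, t)] fun p => p - (x, t) :=
    ((hasFDerivAt_iff_isLittleO.1 hdiff.hasFDerivAt).comp_tendsto hξ_tendsto).trans_isBigO hξ_big
  -- the characteristic through `(ξ p, t)` passes at a distance `o(p - (x, t))` of `p`
  have hnear : (fun p : H × ℝ => Γ p.1 p.2 - (X (σ (ξ p) t) p.2).2)
      =o[𝓝 (x, t)] fun p => p - (x, t) := by
    refine (Asymptotics.IsBigO.of_bound β ?_).trans_isLittleO hfst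
    have hmem : ∀ᶠ p : H × ℝ in 𝓝 (x, t), p.2 ∈ Icc 0 T :=
      continuous_snd.continuousAt.eventually (Icc_mem_nhds ht.1 ht.2)
    filter_upwards [hmem] with p hp
    rw [← hΓX _ p.2 hp]
    refine (hΓlip p.2 hp _ _).trans (le_of_eq ?_)
    rw [← norm_neg]
    congr 2
    simp only [hξ]; abel
  refine hasFDerivAt_iff_isLittleO.2 (((hnear.add hsnd).add hspace).congr_left fun p => ?_)
  simp only [add_apply, ContinuousLinearMap.comp_apply, ContinuousLinearMap.coe_fst',
    ContinuousLinearMap.smulRight_apply, ContinuousLinearMap.coe_snd', hξ, map_sub, map_smul,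
    smul_sub]
  module

variable [CompleteSpace H]

namespace FBHypotheses

variable {A : H → H} {K : H →L[ℝ] H} {F FT : H → ℝ} {γ b ν M νT MT m k T : ℝ}

/-- Through every point `(x, t)` passes exactly one characteristic `X (σ x t)`. Its final value
`σ x t` depends on `x` in a Lipschitz way by the energy estimates, and exists because the map from
the final value to the value at time `t` stays surjective when `t` decreases by a fixed amount. -/
theorem exists_characteristic_through (h : FBHypotheses A K F FT γ b ν M νT MT m k T)
    {X : H → ℝ → H × H} {C : ℝ} (hC : 0 ≤ C)
    (hX : ∀ η, IsFBSolution A K F FT 0 T (X η 0).1 (fun s => (X η s).1) fun s => (X η s).2)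
    (hXT : ∀ η, (X η T).1 = η)
    (hinc : ∀ η η', ∀ s ∈ Icc 0 T, ∀ s' ∈ Icc 0 T,
        ‖(X η s' - X η' s') - (X η s - X η' s)‖ ≤ C * |s' - s| * ‖η - η'‖) :
    ∃ (σ : H → ℝ → H) (c : NNReal), ∀ t ∈ Icc 0 T,
      (∀ x, (X (σ x t) t).1 = x) ∧ (∀ η, σ (X η t).1 t = η) ∧
      LipschitzWith c fun x => σ x t := by
  have hνT := h.νT_pos
  obtain ⟨β, hβ, hcomp⟩ := h.exists_comparison
  set c := √(β / νT) with hc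
  have hc0 : 0 ≤ c := Real.sqrt_nonneg _
  have hanti : ∀ t ∈ Icc 0 T, ∀ η η', ‖η - η'‖ ≤ c * ‖(X η t).1 - (X η' t).1‖ := by
    intro t ht η η'
    have h1 := (hcomp t ht _ _ _ _ _ _ ((hX η).restrict ht.1) ((hX η').restrict ht.1)).2.1
    simp only [hXT] at h1
    refine le_of_sq_le_sq ?_ (by positivity)
    rw [mul_pow, hc, Real.sq_sqrt (by positivity), div_mul_eq_mul_div, le_div_iff₀ hνT]
    linarith
  have hstep : ∀ t ∈ Icc 0 T, ∀ t' ∈ Icc 0 T, c * (C * |t' - t|) < 1 →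
      (Function.Surjective fun η => (X η t).1) → Function.Surjective fun η => (X η t').1 :=
    fun t ht t' ht' hsmall hsurj =>
      surjective_of_lipschitz_perturbation hc0 (by positivity) (hanti t ht) hsurj
        (fun η η' => by
          refine le_trans ?_ (hinc η η' t ht t' ht')
          refine le_trans (le_of_eq ?_) (norm_fst_le _)
          simp only [Prod.fst_sub]
          congr 1; abel) hsmall
  obtain ⟨δ, hδ, hδ'⟩ : ∃ δ : ℝ, 0 < δ ∧ c * (C * δ) < 1 :=
    ⟨1 / (c * C + 1), by positivity, by
      rw [← mul_assoc, mul_one_div, div_lt_one (by positivity)]; linarith⟩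
  have hsurj_aux : ∀ n : ℕ, ∀ t ∈ Icc 0 T, T - n * δ ≤ t →
      Function.Surjective fun η => (X η t).1 := by
    intro n
    induction n with
    | zero =>
      intro t ht hle x
      have htT : t = T := le_antisymm ht.2 (by simpa using hle)
      exact ⟨x, by simp only [htT, hXT]⟩
    | succ n ih =>
      intro t ht hle
      push_cast at hle
      have hT' : min T (t + δ) ∈ Icc 0 T := ⟨le_min h.T_pos.le (by linarith [ht.1]), min_le_left _ _⟩
      refine hstep (min T (t + δ)) hT' t ht ?_ (ih _ hT' (le_min ?_ (by linarith)))
      · refine lt_of_le_of_lt ?_ hδ'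
        gcongr
        rw [abs_sub_comm, abs_of_nonneg (sub_nonneg.2 (le_min ht.2 (by linarith)))]
        linarith [min_le_right T (t + δ)]
      · have : 0 ≤ n * δ := by positivity
        linarith
  have hsurj : ∀ t ∈ Icc 0 T, Function.Surjective fun η => (X η t).1 := by
    intro t ht
    obtain ⟨n, hn⟩ := exists_nat_ge (T / δ)
    rw [div_le_iff₀ hδ] at hn
    exact hsurj_aux n t ht (by linarith [ht.1])
  have hex : ∀ x t, ∃ η, t ∈ Icc 0 T → (X η t).1 = x := fun x t => by
    by_cases ht : t ∈ Icc 0 T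
    · obtain ⟨η, hη⟩ := hsurj t ht x
      exact ⟨η, fun _ => hη⟩
    · exact ⟨0, fun ht' => absurd ht' ht⟩
  choose σ hσ using hex
  refine ⟨σ, ⟨c, hc0⟩, fun t ht => ⟨fun x => hσ x t ht, fun η => ?_, ?_⟩⟩
  · have h1 := hanti t ht (σ (X η t).1 t) η
    rw [hσ _ t ht, sub_self, norm_zero, mul_zero] at h1
    exact sub_eq_zero.1 (norm_eq_zero.1 (le_antisymm h1 (norm_nonneg _)))
  · refine LipschitzWith.of_dist_le_mul fun x x' => ?_
    have h1 := hanti t ht (σ x t) (σ x' t)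
    rw [hσ x t ht, hσ x' t ht] at h1
    rw [dist_eq_norm, dist_eq_norm]
    exact h1

/-- A solution of the decoupling equation takes the value `z s` at `(y s, s)` along any solution
`(y, z)` of the forward-backward system: by the equation the difference `w` satisfies the linear
equation `w' = (DₓΓ K - (DA(y))*) w` with bounded coefficients, and it vanishes at `T`. -/
theorem decouplingSolution_along (h : FBHypotheses A K F FT γ b ν M νT MT m k T) {t : ℝ} {I : Set ℝ}
    (hI : Icc t T ⊆ I) {Γ : H → ℝ → H} (hΓ : IsDecouplingSolution A K F FT T I Γ) (ht : t ≤ T)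
    {x : H} {y z : ℝ → H} (hyz : IsFBSolution A K F FT t T x y z) : Γ x t = z t := by
  have hIoo : Ioo t T ⊆ interior I := interior_maximal (Ioo_subset_Icc_self.trans hI) isOpen_Ioo
  have hγ : 0 ≤ γ := (norm_nonneg _).trans (h.drift_bound 0)
  have hcurve : ContinuousOn (fun s => (y s, s)) (Icc t T) :=
    hyz.continuousOn_y.prodMk continuousOn_id
  have hmaps : MapsTo (fun s => (y s, s)) (Icc t T) (univ ×ˢ I) := fun s hs => ⟨mem_univ _, hI hs⟩
  obtain ⟨C, hC⟩ : ∃ C, ∀ s ∈ Icc t T, ‖fderiv ℝ (fun x' => Γ x' s) (y s)‖ ≤ C := by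
    refine isCompact_Icc.induction_on (p := fun S => ∃ C, ∀ s ∈ S,
      ‖fderiv ℝ (fun x' => Γ x' s) (y s)‖ ≤ C) ⟨0, by simp⟩ ?_ ?_ ?_
    · exact fun S S' hSS' ⟨C, hC⟩ => ⟨C, fun s hs => hC s (hSS' hs)⟩
    · rintro S S' ⟨C, hC⟩ ⟨C', hC'⟩
      exact ⟨max C C', fun s hs => hs.elim (fun hs => (hC s hs).trans (le_max_left _ _))
        fun hs => (hC' s hs).trans (le_max_right _ _)⟩
    · intro s hs
      obtain ⟨C, hC⟩ := hΓ.locally_bounded (y s) s (hI hs)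
      exact ⟨_, (hcurve.continuousWithinAt hs).tendsto_nhdsWithin hmaps hC, C, fun r hr => hr⟩
  set w : ℝ → H := fun s => Γ (y s) s - z s with hw
  have hw_cont : ContinuousOn w (Icc t T) :=
    (hΓ.continuousOn.comp hcurve hmaps).sub hyz.continuousOn_z
  have hw_der : ∀ s ∈ Ioo t T, HasDerivAt w (fderiv ℝ (fun x' => Γ x' s) (y s) (K (w s))
      - ContinuousLinearMap.adjoint (fderiv ℝ A (y s)) (w s)) s := by
    intro s hs
    have hd := (hΓ.differentiableAt (y s) s (hIoo hs)).hasFDerivAt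
    set P := fderiv ℝ (fun p : H × ℝ => Γ p.1 p.2) (y s, s) with hP
    have hspace : HasFDerivAt (fun x' => Γ x' s) (P.comp (ContinuousLinearMap.inl ℝ H ℝ)) (y s) :=
      HasFDerivAt.comp (y s) (f := fun x' => (x', s)) hd (hasFDerivAt_prodMk_left (y s) s)
    have htime : HasDerivAt (fun r => Γ (y s) r) (P (0, 1)) s :=
      HasFDerivAt.comp_hasDerivAt s (f := fun r => (y s, r)) hd
        ((hasDerivAt_const s (y s)).prodMk (hasDerivAt_id s))
    have halong : HasDerivAt (fun r => Γ (y r) r) (P (A (y s) - K (z s), 1)) s :=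
      HasFDerivAt.comp_hasDerivAt s (f := fun r => (y r, r)) hd
        ((hyz.forward s hs).prodMk (hasDerivAt_id s))
    have heq := hΓ.equation (y s) s (hIoo hs)
    rw [htime.deriv] at heq
    rw [hspace.fderiv] at heq ⊢
    refine (halong.sub (hyz.backward s hs)).congr_deriv ?_
    have hsplit : P (A (y s) - K (z s), 1) = P (A (y s), 0) - P (K (z s), 0) + P (0, 1) := by
      rw [← map_sub, ← map_add]; simp
    rw [hsplit, ← neg_neg (P (0, 1)), heq, hw]
    simp only [ContinuousLinearMap.comp_apply, ContinuousLinearMap.inl_apply, map_sub]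
    abel
  set c : ℝ := |C| * ‖K‖ + γ with hc
  -- with this weight the squared norm of the difference is nondecreasing in time
  have hanti : AntitoneOn (fun s => -(Real.exp (2 * c * s) * ⟪w s, w s⟫_ℝ)) (Icc t T) := by
    have hexp : ∀ s, HasDerivAt (fun s => Real.exp (2 * c * s))
        (Real.exp (2 * c * s) * (2 * c)) s := fun s => by
      simpa using ((hasDerivAt_id s).const_mul (2 * c)).exp
    refine antitoneOn_Icc_of_hasDerivAt_nonpos ?_
      (fun s hs => ((hexp s).mul ((hw_der s hs).inner ℝ (hw_der s hs))).neg) fun s hs => ?_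
    · exact ((by fun_prop : Continuous fun s => Real.exp (2 * c * s)).continuousOn.mul
        (hw_cont.inner hw_cont)).neg
    · set w' := fderiv ℝ (fun x' => Γ x' s) (y s) (K (w s))
        - ContinuousLinearMap.adjoint (fderiv ℝ A (y s)) (w s) with hw'
      have h1 : ‖w'‖ ≤ c * ‖w s‖ := by
        refine (norm_sub_le _ _).trans ?_
        rw [hc, add_mul]
        refine add_le_add ?_ (h.norm_adjoint_le _ _)
        refine (ContinuousLinearMap.le_opNorm _ _).trans ?_
        rw [mul_assoc]
        gcongr
        · exact (hC s (Ioo_subset_Icc_self hs)).trans (le_abs_self C)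
        · exact K.le_opNorm _
      have h2 := (abs_le.1 (abs_real_inner_le_norm (w s) w')).1
      have h3 : ‖w s‖ * ‖w'‖ ≤ c * ‖w s‖ ^ 2 := by
        calc _ ≤ ‖w s‖ * (c * ‖w s‖) := by gcongr
          _ = _ := by ring
      rw [real_inner_comm (w s) w', real_inner_self_eq_norm_sq]
      have h4 : 0 ≤ Real.exp (2 * c * s) * (2 * (c * ‖w s‖ ^ 2 + ⟪w s, w'⟫_ℝ)) :=
        mul_nonneg (Real.exp_pos _).le (by linarith)
      linarith
  have hwT : w T = 0 := by rw [hw]; simp only [hΓ.final, hyz.final, sub_self]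
  have h1 := hanti (left_mem_Icc.2 ht) (right_mem_Icc.2 ht) ht
  simp only [hwT, inner_zero_left, mul_zero, neg_zero] at h1
  rw [real_inner_self_eq_norm_sq] at h1
  have h2 : ‖w t‖ ^ 2 ≤ 0 := nonpos_of_mul_nonpos_right (by linarith) (Real.exp_pos (2 * c * t))
  have h3 : w t = 0 :=
    norm_eq_zero.1 (pow_eq_zero_iff two_ne_zero |>.1 (le_antisymm h2 (sq_nonneg _)))
  rw [hw] at h3
  simp only [hyz.initial] at h3
  exact sub_eq_zero.1 h3

end FBHypotheses

end Decoupling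

namespace FBHypotheses

variable {H : Type*} [NormedAddCommGroup H] [InnerProductSpace ℝ H] [CompleteSpace H]
  {A : H → H} {K : H →L[ℝ] H} {F FT : H → ℝ} {γ b ν M νT MT m k T : ℝ}

theorem exists_isFBSolution (h : FBHypotheses A K F FT γ b ν M νT MT m k T) {t : ℝ}
    (ht : t ∈ Icc 0 T) (x : H) : ∃ y z : ℝ → H, IsFBSolution A K F FT t T x y z := by
  obtain ⟨X, C, hC, hX, hXT, -, -, hinc, -⟩ := h.exists_characteristics
  obtain ⟨σ, c, hσ⟩ := h.exists_characteristic_through hC hX hXT hinc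
  have h1 := (hX (σ x t)).restrict ht.1
  rw [(hσ t ht).1 x] at h1
  exact ⟨_, _, h1⟩

theorem eqOn_of_isFBSolution (h : FBHypotheses A K F FT γ b ν M νT MT m k T) {t : ℝ}
    (ht : t ∈ Icc 0 T) {x : H} {y z y' z' : ℝ → H} (hyz : IsFBSolution A K F FT t T x y z)
    (hyz' : IsFBSolution A K F FT t T x y' z') : EqOn y' y (Icc t T) ∧ EqOn z' z (Icc t T) := by
  obtain ⟨β, -, hcomp⟩ := h.exists_comparison
  exact (hcomp t ht x x y' z' y z hyz' hyz).2.2 rfl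

/-- The decoupling field `Γ (x, t)` is the value at time `t` of the backward variable of the
characteristic through `(x, t)`. -/
theorem exists_decouplingField (h : FBHypotheses A K F FT γ b ν M νT MT m k T) :
    ∃ Γ : H → ℝ → H, IsDecouplingSolution A K F FT T (Icc 0 T) Γ ∧
      (∃ C : ℝ, ∀ x : H, ∀ t ∈ Icc 0 T,
        ‖Γ x t‖ ≤ C * ‖x‖ ∧ ‖fderiv ℝ (fun x' : H => Γ x' t) x‖ ≤ C) ∧
      ∀ t ∈ Icc 0 T, ∀ x : H, ∀ y z : ℝ → H, IsFBSolution A K F FT t T x y z →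
        ∀ s ∈ Icc t T, z s = Γ (y s) s := by
  obtain ⟨X, C, hC, hX, hXT, hXcont, hXder, hinc, hXdiff⟩ := h.exists_characteristics
  obtain ⟨σ, c, hσ⟩ := h.exists_characteristic_through hC hX hXT hinc
  obtain ⟨β, hβ, hcomp⟩ := h.exists_comparison
  set α := alphaCoeff γ M MT νT k T 0 with hα
  set Γ : H → ℝ → H := fun x t => (X (σ x t) t).2 with hΓ
  have hsol : ∀ x, ∀ t ∈ Icc 0 T, IsFBSolution A K F FT t T x (fun s => (X (σ x t) s).1)
      fun s => (X (σ x t) s).2 := fun x t ht => by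
    have h1 := (hX (σ x t)).restrict ht.1
    rwa [(hσ t ht).1 x] at h1
  have hdec : ∀ t ∈ Icc 0 T, ∀ x : H, ∀ y z : ℝ → H, IsFBSolution A K F FT t T x y z →
      ∀ s ∈ Icc t T, z s = Γ (y s) s := fun t ht x y z hyz s hs => by
    have hs' : s ∈ Icc 0 T := ⟨ht.1.trans hs.1, hs.2⟩
    exact (h.eqOn_of_isFBSolution hs' (hsol (y s) s hs') (hyz.restrict hs.1)).2
      (left_mem_Icc.2 hs.2)
  have hΓX : ∀ η, ∀ s ∈ Icc 0 T, Γ (X η s).1 s = (X η s).2 := fun η s hs => by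
    simp only [hΓ, (hσ s hs).2.1 η]
  have hΓle : ∀ x, ∀ t ∈ Icc 0 T, ‖Γ x t‖ ≤ α * ‖x‖ := fun x t ht => by
    have h1 := h.norm_backward_le ht (hsol x t ht) (left_mem_Icc.2 ht.2)
    simpa only [(hσ t ht).1 x] using h1
  have hΓlip : ∀ t ∈ Icc 0 T, ∀ x x', ‖Γ x t - Γ x' t‖ ≤ β * ‖x - x'‖ := fun t ht x x' => by
    have h1 := (hcomp t ht _ _ _ _ _ _ (hsol x t ht) (hsol x' t ht)).1 t (left_mem_Icc.2 ht.2)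
    simpa only [(hσ t ht).1] using h1
  have hΓdiff : ∀ t ∈ Icc 0 T, Differentiable ℝ fun x => Γ x t := fun t ht x => by
    have h1 : DifferentiableAt ℝ (fun x => σ x t) x :=
      differentiableAt_inverse_of_lipschitzWith (f := fun η => (X η t).1) (hσ t ht).2.2
        (hσ t ht).1 (hσ t ht).2.1 (hXdiff t _).fst
    exact (DifferentiableAt.comp x (g := fun η => X η t) (hXdiff t _) h1).snd
  have hΓderiv : ∀ x, ∀ t ∈ Icc 0 T, ‖fderiv ℝ (fun x' : H => Γ x' t) x‖ ≤ β := fun x t ht =>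
    norm_fderiv_le_of_lipschitz ℝ (C := ⟨β, hβ.le⟩) (LipschitzWith.of_dist_le_mul fun x x' => by
      rw [dist_eq_norm, dist_eq_norm]; exact hΓlip t ht x x')
  have hΓfderiv : ∀ x, ∀ t ∈ Ioo 0 T, HasFDerivAt (fun p : H × ℝ => Γ p.1 p.2)
      ((fderiv ℝ (fun x => Γ x t) x).comp (ContinuousLinearMap.fst ℝ H ℝ)
        + (ContinuousLinearMap.snd ℝ H ℝ).smulRight
          (-(ContinuousLinearMap.adjoint (fderiv ℝ A x) (Γ x t) + ∇ F x)
            - fderiv ℝ (fun x => Γ x t) x (A x - K (Γ x t)))) (x, t) := fun x t ht => by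
    have ht' := Ioo_subset_Icc_self ht
    refine hasFDerivAt_field hinc hΓlip hΓX ht (hσ t ht').1 (hσ t ht').2.2.continuous ?_
      (hΓdiff t ht' x)
    refine (hXder (σ x t) t ht).congr_deriv ?_
    simp only [reversedField, (hσ t ht').1 x, hΓ]
    ext <;> simp
  refine ⟨Γ, ⟨?_, ?_, hΓdiff, fun x t ht => ⟨β, ?_⟩, ?_, fun x => ?_⟩,
    ⟨max α β, fun x t ht => ⟨(hΓle x t ht).trans (by gcongr; exact le_max_left _ _),
      (hΓderiv x t ht).trans (le_max_right _ _)⟩⟩, hdec⟩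
  · rintro ⟨x, t⟩ ⟨-, ht⟩
    -- compare with the values along the characteristic through `(x, t)`
    have hXc := hXcont (σ x t)
    have hbound : ∀ᶠ p : H × ℝ in 𝓝[univ ×ˢ Icc 0 T] (x, t),
        ‖Γ p.1 p.2 - Γ x t‖ ≤ β * ‖p.1 - (X (σ x t) p.2).1‖
          + ‖(X (σ x t) p.2).2 - (X (σ x t) t).2‖ := by
      filter_upwards [self_mem_nhdsWithin] with p hp
      rw [← sub_add_sub_cancel (Γ p.1 p.2) (X (σ x t) p.2).2 (Γ x t)]
      refine (norm_add_le _ _).trans (add_le_add ?_ le_rfl)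
      rw [← hΓX _ p.2 hp.2]
      exact hΓlip p.2 hp.2 _ _
    have hlim : Tendsto (fun p : H × ℝ => β * ‖p.1 - (X (σ x t) p.2).1‖
          + ‖(X (σ x t) p.2).2 - (X (σ x t) t).2‖) (𝓝 (x, t)) (𝓝 0) := by
      have hc : Continuous fun p : H × ℝ => β * ‖p.1 - (X (σ x t) p.2).1‖
          + ‖(X (σ x t) p.2).2 - (X (σ x t) t).2‖ := by fun_prop
      simpa [(hσ t ht).1] using hc.tendsto (x, t)
    exact tendsto_iff_norm_sub_tendsto_zero.2 (squeeze_zero'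
      (Eventually.of_forall fun p => norm_nonneg _) hbound (hlim.mono_left nhdsWithin_le_nhds))
  · intro x t ht
    rw [interior_Icc] at ht
    exact (hΓfderiv x t ht).differentiableAt
  · filter_upwards [self_mem_nhdsWithin] with p hp using hΓderiv p.1 p.2 hp.2
  · intro x t ht
    rw [interior_Icc] at ht
    have h1 : HasDerivAt (fun s => Γ x s) _ t :=
      HasFDerivAt.comp_hasDerivAt t (f := fun s => (x, s)) (hΓfderiv x t ht)
        ((hasDerivAt_const t x).prodMk (hasDerivAt_id t))
    rw [h1.deriv]
    simp only [add_apply, ContinuousLinearMap.comp_apply, ContinuousLinearMap.coe_fst',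
      ContinuousLinearMap.smulRight_apply, ContinuousLinearMap.coe_snd', map_zero, one_smul,
      map_sub]
    abel
  · have hT : T ∈ Icc 0 T := right_mem_Icc.2 h.T_pos.le
    have h1 := (hX (σ x T)).final
    simpa only [(hσ T hT).1 x] using h1

end FBHypotheses

/-! ### Existence, uniqueness and decoupling -/

theorem mainTheorem1 {H V : Type*}
    [NormedAddCommGroup H] [InnerProductSpace ℝ H] [CompleteSpace H]
    [NormedAddCommGroup V] [InnerProductSpace ℝ V] [CompleteSpace V]
    (A : H → H) (F FT : H → ℝ) (B : V →L[ℝ] H) (N : V ≃L[ℝ] V)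
    (γ b ν M νT MT m k T : ℝ) (hT : 0 < T)
    -- the drift
    (hA_zero : A 0 = 0) (hA_C1 : ContDiff ℝ 1 A) (hA_bound : ∀ x, ‖fderiv ℝ A x‖ ≤ γ)
    (hA_diff2 : Differentiable ℝ (fderiv ℝ A))
    (hA_lip : ∀ x₁ x₂, ‖fderiv ℝ A x₁ - fderiv ℝ A x₂‖ ≤ b * ‖x₁ - x₂‖ / (1 + max ‖x₁‖ ‖x₂‖))
    -- the running cost
    (hν : 0 < ν) (hF_C2 : ContDiff ℝ 2 F) (hF_zero : F 0 = 0) (hF_grad : ∇ F 0 = 0)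
    (hF_hess : ∀ x ξ, ν * ‖ξ‖ ^ 2 ≤ ⟪fderiv ℝ (∇ F) x ξ, ξ⟫_ℝ ∧
      ⟪fderiv ℝ (∇ F) x ξ, ξ⟫_ℝ ≤ M * ‖ξ‖ ^ 2)
    -- the terminal cost
    (hνT : 0 < νT) (hFT_C2 : ContDiff ℝ 2 FT) (hFT_zero : FT 0 = 0) (hFT_grad : ∇ FT 0 = 0)
    (hFT_hess : ∀ x ξ, νT * ‖ξ‖ ^ 2 ≤ ⟪fderiv ℝ (∇ FT) x ξ, ξ⟫_ℝ ∧
      ⟪fderiv ℝ (∇ FT) x ξ, ξ⟫_ℝ ≤ MT * ‖ξ‖ ^ 2)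
    -- the control operators
    (hN : IsSelfAdjoint (N : V →L[ℝ] V)) (hm : 0 < m)
    (hBN : ∀ ξ, m * ‖ξ‖ ^ 2 ≤ ⟪controlOp B N ξ, ξ⟫_ℝ)
    -- the conditions on the constants
    (hk_pos : 0 < k) (hk_lt : k < min m ν) (hb_small : b ^ 2 / 16 < (m - k) * (ν - k))
    (hα : 0 < ν - b * alphaCoeff γ M MT νT k T 0)
    (hγ : γ ^ 2 < M * ‖controlOp B N‖) :
    -- the forward-backward system has one and only one solution
    (∀ t ∈ Icc 0 T, ∀ x : H, ∃ y z : ℝ → H,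
      IsFBSolution A (controlOp B N) F FT t T x y z ∧
      ∀ y' z' : ℝ → H, IsFBSolution A (controlOp B N) F FT t T x y' z' →
        EqOn y' y (Icc t T) ∧ EqOn z' z (Icc t T)) ∧
    -- the decoupling equation has one and only one solution on `[0, T]`
    ∃ Γ : H → ℝ → H, IsDecouplingSolution A (controlOp B N) F FT T (Icc 0 T) Γ ∧
      (∀ Γ' : H → ℝ → H, IsDecouplingSolution A (controlOp B N) F FT T (Icc 0 T) Γ' →
        ∀ x : H, ∀ t ∈ Icc 0 T, Γ' x t = Γ x t) ∧
      -- it has linear growth and a bounded gradient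
      (∃ C : ℝ, ∀ x : H, ∀ t ∈ Icc 0 T,
        ‖Γ x t‖ ≤ C * ‖x‖ ∧ ‖fderiv ℝ (fun x' : H => Γ x' t) x‖ ≤ C) ∧
      -- it extends every local solution
      (∀ h ∈ Ioc 0 T, ∀ Γ' : H → ℝ → H,
        IsDecouplingSolution A (controlOp B N) F FT T (Ioc (T - h) T) Γ' →
        ∀ x : H, ∀ t ∈ Ioc (T - h) T, Γ' x t = Γ x t) ∧
      -- it decouples the forward-backward system
      (∀ t ∈ Icc 0 T, ∀ x : H, ∀ y z : ℝ → H,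
        IsFBSolution A (controlOp B N) F FT t T x y z →
        ∀ s ∈ Icc t T, z s = Γ (y s) s) := by
  have hH : Nontrivial H := by
    by_contra hn
    have := not_nontrivial_iff_subsingleton.1 hn
    have h0 : controlOp B N = 0 := Subsingleton.elim _ _
    rw [h0, norm_zero, mul_zero] at hγ
    exact absurd hγ (not_lt.2 (sq_nonneg γ))
  obtain ⟨e, he⟩ := exists_norm_eq H (zero_le_one (α := ℝ))
  have hM : 0 ≤ M := by
    have h1 := hF_hess 0 e
    rw [he] at h1
    linarith [h1.1, h1.2]
  have hMT : 0 < MT := by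
    have h1 := hFT_hess 0 e
    rw [he] at h1
    linarith [h1.1, h1.2]
  have hb : 0 ≤ b := by
    have h1 := (norm_nonneg _).trans (hA_lip e 0)
    rw [sub_zero, norm_zero, he] at h1
    norm_num at h1
    linarith
  have h : FBHypotheses A (controlOp B N) F FT γ b ν M νT MT m k T :=
    { T_pos := hT
      drift_zero := hA_zero
      drift_diff := hA_C1.differentiable one_ne_zero
      drift_diff2 := hA_diff2
      drift_bound := hA_bound
      drift_lip := hA_lip
      b_nonneg := hb
      grad_diff := hF_C2.gradient.differentiable one_ne_zero
      grad_zero := hF_grad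
      grad_mono := strong_monotone_gradient hF_C2 hF_hess
      grad_lip := lipschitz_gradient hF_C2 hν.le hM hF_hess
      M_nonneg := hM
      gradT_diff := hFT_C2.gradient.differentiable one_ne_zero
      gradT_zero := hFT_grad
      gradT_mono := strong_monotone_gradient hFT_C2 hFT_hess
      gradT_lip := lipschitz_gradient hFT_C2 hνT.le hMT.le hFT_hess
      νT_pos := hνT
      MT_pos := hMT
      control_coercive := hBN
      k_pos := hk_pos
      k_lt_m := hk_lt.trans_le (min_le_left _ _)
      k_lt_ν := hk_lt.trans_le (min_le_right _ _)
      b_small := hb_small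
      alpha_small := hα }
  obtain ⟨Γ, hΓ, hbound, hdec⟩ := h.exists_decouplingField
  -- any solution of the decoupling equation agrees with `Γ` by evaluating both on characteristics
  have huniq : ∀ (I : Set ℝ) (Γ' : H → ℝ → H),
      IsDecouplingSolution A (controlOp B N) F FT T I Γ' →
      ∀ x : H, ∀ t ∈ Icc 0 T, Icc t T ⊆ I → Γ' x t = Γ x t := fun I Γ' hΓ' x t ht hI => by
    obtain ⟨y, z, hyz⟩ := h.exists_isFBSolution ht x
    rw [h.decouplingSolution_along hI hΓ' ht.2 hyz, hdec t ht x y z hyz t (left_mem_Icc.2 ht.2),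
      hyz.initial]
  refine ⟨fun t ht x => ?_, Γ, hΓ, fun Γ' hΓ' x t ht => ?_, hbound, fun τ hτ Γ' hΓ' x t ht => ?_,
    hdec⟩
  · obtain ⟨y, z, hyz⟩ := h.exists_isFBSolution ht x
    exact ⟨y, z, hyz, fun y' z' hyz' => h.eqOn_of_isFBSolution ht hyz hyz'⟩
  · exact huniq _ Γ' hΓ' x t ht (Icc_subset_Icc_left ht.1)
  · exact huniq _ Γ' hΓ' x t ⟨by linarith [hτ.2, ht.1], ht.2⟩ fun s hs =>
      ⟨ht.1.trans_le hs.1, hs.2⟩
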